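/- All trees are nonempty, possibly infinite (of any cardinality, with vertices of any degree), and unrooted. A tree $T$ is a \emph{graph minor} of a tree $S$, written $T \leq^* S$, if there is a map $\mu$ assigning to each vertex $v$ of $T$ a nonempty connected subgraph $\mu(v)$ of $S$ such that $\mu(v)\cap\mu(w)=\emptyset$ whenever $v\neq w$, and for every edge $vw$ of $T$ there is an edge of $S$ with one end in $\mu(v)$ and the other in $\mu(w)$. Trees $T,S$ are \emph{mutual minors}, $T\equiv^* S$, if $T\leq^* S$ and $S\leq^* T$. A \emph{ray} is a one-way infinite path $v_1v_2\ldots$ with distinct vertices; a ray in $T$ is \emph{eventually bare} if there is an $M$ such that $\deg_T(v_n)=2$ for all $n\geq M$. A tree is \emph{small} if each of its rays is eventually bare. \textbf{Theorem.} For every small tree $T$, the number of isomorphism classes of trees $S$ with $S\equiv^* T$ is either $1$ or infinite. -/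

import Mathlib

open scoped Cardinal

universe u v w

/-- A model of the graph `G` in the graph `H`: to every vertex of `G` a nonempty connected
piece of `H` is assigned (given by its set of vertices), pieces of distinct vertices are disjoint,
and pieces of adjacent vertices are joined by an edge of `H`. -/
structure MinorModel {V : Type v} {W : Type w} (G : SimpleGraph V) (H : SimpleGraph W) where
  /-- The piece of `H` assigned to a vertex of `G`. -/
  branch : V → Set W
  /-- Each piece is connected (in particular nonempty). -/
  connected : ∀ x, (H.induce (branch x)).Connected
  disjoint : ∀ x y, x ≠ y → Disjoint (branch x) (branch y)
  adj : ∀ x y, G.Adj x y → ∃ a ∈ branch x, ∃ b ∈ branch y, H.Adj a b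

/-- `G` is a graph minor of `H`. -/
def IsGraphMinor {V : Type v} {W : Type w} (G : SimpleGraph V) (H : SimpleGraph W) : Prop :=
  Nonempty (MinorModel G H)

/-- `G` and `H` are mutual (graph) minors: each of them is a graph minor of the other. -/
def AreMutualMinors {V : Type v} {W : Type w} (G : SimpleGraph V) (H : SimpleGraph W) : Prop :=
  IsGraphMinor G H ∧ IsGraphMinor H G

/-- A ray of `G`: a one-way infinite path, given by its sequence of distinct vertices. -/
structure IsRay {V : Type v} (G : SimpleGraph V) (R : ℕ → V) : Prop where
  injective : Function.Injective R
  adj : ∀ n, G.Adj (R n) (R (n + 1))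

/-- From some index on, all vertices of the sequence have degree two in `G`. -/
def IsEventuallyBare {V : Type v} (G : SimpleGraph V) (R : ℕ → V) : Prop :=
  ∃ M : ℕ, ∀ n, M ≤ n → (G.neighborSet (R n)).encard = 2

/-- A small tree: a tree in which every ray is eventually bare. -/
structure IsSmallTree {V : Type v} (T : SimpleGraph V) : Prop where
  isTree : T.IsTree
  bare : ∀ R : ℕ → V, IsRay T R → IsEventuallyBare T R

/-- The trees that are mutual minors of `T`. A graph minor of `T` has at most as many vertices
as `T`, so up to isomorphism each of them has its vertices in the universe of `T`. -/
structure MutualMinorTree {V : Type u} (T : SimpleGraph V) where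
  /-- The type of vertices. -/
  Vert : Type u
  /-- The graph. -/
  graph : SimpleGraph Vert
  isTree : graph.IsTree
  mutual_minors : AreMutualMinors T graph

/-- Isomorphism of trees that are mutual minors of `T`. -/
instance MutualMinorTree.isoSetoid {V : Type u} (T : SimpleGraph V) :
    Setoid (MutualMinorTree T) where
  r A B := Nonempty (A.graph ≃g B.graph)
  iseqv :=
    { refl := fun _ => ⟨SimpleGraph.Iso.refl⟩
      symm := fun ⟨e⟩ => ⟨e.symm⟩
      trans := fun ⟨e⟩ ⟨f⟩ => ⟨e.trans f⟩ }

/-- The class of all trees that are mutual minors of `T`, taken up to graph isomorphism. -/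
def MutualMinorClass {V : Type u} (T : SimpleGraph V) : Type (u + 1) :=
  Quotient (MutualMinorTree.isoSetoid T)

/-! The rooted case is settled first and then transferred. For rooted trees the root must lie in the
piece of the root, and such minors can be read off branch by branch: `node c ≤ node d` holds iff the
branches of `c` can be distributed over those of `d` so that, for each `j`, the ones sent to `j` fit
together, under a root, into `single (d j)` (`exists_fibers_of_node_le`, `node_le_of_fibers`).

Let `e` be a rooted tree and count the branches equivalent to `e`. If two equivalent rooted trees
have different counts, then some tree in their class has finite count and absorbs a further copy of
`e`; adding copies gives infinitely many types (`manyTypes_of_count_lt`). If all counts are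
determined by the class, then equivalent trees have branches that match up to equivalence, so the
dichotomy "one or infinitely many types" passes from the branches to the tree (`dichotomy_node`).
Were it to fail for a small tree, it would fail along a whole ray of successive branches; the ray is
eventually bare, so some such branch is itself a ray, whose only equivalent is itself.

To forget the root of a small tree with a vertex of degree at least three, a pivot is used: vertices
`x`, `y` such that every self-model `h` has `x` in the piece of `x` or of `y`, while some self-model
has `y` in the piece of `x` (`exists_pivot`). Every mutual minor of `T` then carries a root making
it equivalent to `T` rooted at `x` (`exists_equi_root`), and at most two vertices of it can serve
(`not_three_roots`). Hence one rooted type yields one unrooted type, and infinitely many yield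
infinitely many. Behind both facts is `not_before_of_mapsTo`: a self-model cannot push a directed
edge with branching ahead strictly forward, since iterating it would produce a ray that is not
eventually bare.

Trees without branching vertices are finite paths, rays and double rays, and these are determined by
their class. -/

/-! ### Connected pieces -/

/-- Induction along a connected piece of a graph. -/
theorem SimpleGraph.Connected.induction_on_induce {V : Type v} {G : SimpleGraph V} {S : Set V}
    (h : (G.induce S).Connected) {P : V → Prop} {a : V} (ha : a ∈ S) (h0 : P a)
    (hs : ∀ x ∈ S, ∀ y ∈ S, G.Adj x y → P x → P y) : ∀ b ∈ S, P b := by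
  intro b hb
  have h1 := (SimpleGraph.reachable_iff_reflTransGen _ _).1 (h.preconnected ⟨a, ha⟩ ⟨b, hb⟩)
  have key : ∀ z : S, Relation.ReflTransGen (G.induce S).Adj ⟨a, ha⟩ z → P z.1 := by
    intro z hz
    induction hz with
    | refl => exact h0
    | tail _ h2 ih => exact hs _ (Subtype.property _) _ (Subtype.property _) h2 ih
  exact key _ h1

/-- Converse of `SimpleGraph.Connected.induction_on_induce`. With connectedness phrased as an
induction principle, pieces of models are handled without walks. -/
theorem connected_induce_of {V : Type v} {G : SimpleGraph V} {S : Set V} {a : V} (ha : a ∈ S)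
    (h : ∀ P : V → Prop, P a → (∀ x ∈ S, ∀ y ∈ S, G.Adj x y → P x → P y) → ∀ b ∈ S, P b) :
    (G.induce S).Connected := by
  have h1 : ∀ z : S, (G.induce S).Reachable ⟨a, ha⟩ z := by
    intro z
    obtain ⟨h2, h3⟩ := h (fun b => ∃ hb : b ∈ S, (G.induce S).Reachable ⟨a, ha⟩ ⟨b, hb⟩)
      ⟨ha, SimpleGraph.Reachable.refl _⟩ (by
        rintro x hx y hy hxy ⟨_, h2⟩
        exact ⟨hy, h2.trans (SimpleGraph.Adj.reachable (by simpa using hxy))⟩) z.1 z.2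
    exact h3
  exact { preconnected := fun x y => (h1 x).symm.trans (h1 y), nonempty := ⟨⟨a, ha⟩⟩ }

theorem SimpleGraph.Connected.induction_on {V : Type v} {G : SimpleGraph V}
    (h : G.Connected) {P : V → Prop} {a : V} (h0 : P a)
    (hs : ∀ x y, G.Adj x y → P x → P y) (b : V) : P b := by
  have h1 := (SimpleGraph.reachable_iff_reflTransGen _ _).1 (h.preconnected a b)
  induction h1 with
  | refl => exact h0
  | tail _ h2 ih => exact hs _ _ h2 ih

theorem connected_of_induction {V : Type v} {G : SimpleGraph V} (a : V)
    (h : ∀ P : V → Prop, P a → (∀ x y, G.Adj x y → P x → P y) → ∀ b, P b) :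
    G.Connected := by
  have h1 : ∀ z, G.Reachable a z := h _ (SimpleGraph.Reachable.refl _)
    fun x y hxy h2 => h2.trans hxy.reachable
  exact { preconnected := fun x y => (h1 x).symm.trans (h1 y), nonempty := ⟨a⟩ }

/-! ### Composition of minor models -/

namespace MinorModel

variable {U : Type u} {V : Type v} {W : Type w}
  {F : SimpleGraph U} {G : SimpleGraph V} {H : SimpleGraph W}

theorem nonempty_branch (m : MinorModel G H) (x : V) : (m.branch x).Nonempty := by
  obtain ⟨a⟩ := (m.connected x).nonempty
  exact ⟨a.1, a.2⟩

theorem eq_of_mem (m : MinorModel G H) {x y : V} {a : W} (hx : a ∈ m.branch x)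
    (hy : a ∈ m.branch y) : x = y := by
  by_contra h
  exact Set.disjoint_left.1 (m.disjoint x y h) hx hy

/-- The model of a graph in an isomorphic graph. -/
def ofIso (e : G ≃g H) : MinorModel G H where
  branch x := {e x}
  connected x := connected_induce_of (Set.mem_singleton _) (by
    rintro P h0 - b rfl
    exact h0)
  disjoint x y h := by simpa using h
  adj x y h := ⟨e x, rfl, e y, rfl, e.map_adj_iff.2 h⟩

/-- The image of a connected set under a model is connected. -/
theorem induction_biUnion (m : MinorModel G H) {S : Set V} (hS : (G.induce S).Connected)
    {P : W → Prop} {a : W} (ha : ∃ x ∈ S, a ∈ m.branch x) (h0 : P a)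
    (hs : ∀ x, (∃ z ∈ S, x ∈ m.branch z) → ∀ y, (∃ z ∈ S, y ∈ m.branch z) →
      H.Adj x y → P x → P y) : ∀ z ∈ S, ∀ b ∈ m.branch z, P b := by
  obtain ⟨x, hx, hax⟩ := ha
  refine hS.induction_on_induce (P := fun z => ∀ b ∈ m.branch z, P b) hx ?_ ?_
  · exact (m.connected x).induction_on_induce hax h0
      (fun p hp q hq => hs p ⟨x, hx, hp⟩ q ⟨x, hx, hq⟩)
  · intro p hp q hq hpq h1
    obtain ⟨c, hc, d, hd, hcd⟩ := m.adj p q hpq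
    exact (m.connected q).induction_on_induce hd (hs c ⟨p, hp, hc⟩ d ⟨q, hq, hd⟩ hcd (h1 c hc))
      (fun r hr s hs' => hs r ⟨q, hq, hr⟩ s ⟨q, hq, hs'⟩)

/-- Composition of models. -/
def comp (m : MinorModel G H) (k : MinorModel F G) : MinorModel F H where
  branch x := {a | ∃ z ∈ k.branch x, a ∈ m.branch z}
  connected x := by
    obtain ⟨z, hz⟩ := k.nonempty_branch x
    obtain ⟨a, ha⟩ := m.nonempty_branch z
    refine connected_induce_of (a := a) ⟨z, hz, ha⟩ ?_
    rintro P h0 h1 b ⟨y, hy, hb⟩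
    exact m.induction_biUnion (k.connected x) ⟨z, hz, ha⟩ h0 h1 y hy b hb
  disjoint x y h := by
    rw [Set.disjoint_left]
    rintro a ⟨z, hz, ha⟩ ⟨z', hz', ha'⟩
    obtain rfl := m.eq_of_mem ha ha'
    exact h (k.eq_of_mem hz hz')
  adj x y h := by
    obtain ⟨a, ha, b, hb, hab⟩ := k.adj x y h
    obtain ⟨c, hc, d, hd, hcd⟩ := m.adj a b hab
    exact ⟨c, ⟨a, ha, hc⟩, d, ⟨b, hb, hd⟩, hcd⟩

end MinorModel

/-! ### Acyclic graphs and the two sides of an edge -/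

/-- A walk between the ends of an edge must cross any cut that separates them; if the edge is the
only one in the cut, it is a bridge. -/
theorem isAcyclic_of_cuts {V : Type v} {G : SimpleGraph V}
    (h : ∀ a b, G.Adj a b → ∃ P : V → Prop, ¬ (P a ↔ P b) ∧
      ∀ x y, G.Adj x y → P x → ¬ P y → s(x, y) = s(a, b)) : G.IsAcyclic := by
  rw [SimpleGraph.isAcyclic_iff_forall_adj_isBridge]
  intro a b hab
  rw [SimpleGraph.isBridge_iff]
  intro hr
  obtain ⟨P, hP, hc⟩ := h a b hab
  rw [SimpleGraph.reachable_iff_reflTransGen] at hr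
  have : ∀ z, Relation.ReflTransGen (G.deleteEdges {s(a, b)}).Adj a z → (P a ↔ P z) := by
    intro z hz
    induction hz with
    | refl => exact Iff.rfl
    | @tail x y _ h2 ih =>
      rw [SimpleGraph.deleteEdges_adj] at h2
      refine ih.trans ⟨fun hx => ?_, fun hy => ?_⟩
      · by_contra hy
        exact h2.2 (hc x y h2.1 hx hy)
      · by_contra hx
        exact h2.2 (by rw [Set.mem_singleton_iff, Sym2.eq_swap]; exact hc y x h2.1.symm hy hx)
  exact hP (this _ hr)

/-- The vertices that can be reached from `b` without passing through `a`. -/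
inductive Side {V : Type v} (G : SimpleGraph V) (a b : V) : V → Prop
  | base : Side G a b b
  | step {x y : V} : Side G a b x → G.Adj x y → y ≠ a → Side G a b y

namespace Side

variable {V : Type v} {G : SimpleGraph V} {a b c d x y : V}

theorem ne (hab : G.Adj a b) (h : Side G a b x) : x ≠ a := by
  cases h with
  | base => exact hab.ne'
  | step _ _ h => exact h

theorem not_self (hab : G.Adj a b) : ¬ Side G a b a := fun h => h.ne hab rfl

theorem cover (hG : G.Connected) (x : V) : Side G a b x ∨ Side G b a x := by
  refine hG.induction_on (P := fun x => Side G a b x ∨ Side G b a x) (Or.inl .base) ?_ x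
  rintro x y hxy (h | h)
  · by_cases hy : y = a
    · subst hy; exact Or.inr .base
    · exact Or.inl (h.step hxy hy)
  · by_cases hy : y = b
    · subst hy; exact Or.inl .base
    · exact Or.inr (h.step hxy hy)

theorem reachable (h : Side G a b x) (hab : G.Adj a b) :
    (G.deleteEdges {s(a, b)}).Reachable b x := by
  induction h with
  | base => exact SimpleGraph.Reachable.refl _
  | @step x y hx hxy hy ih =>
    refine ih.trans (SimpleGraph.Adj.reachable ?_)
    rw [SimpleGraph.deleteEdges_adj]
    refine ⟨hxy, ?_⟩
    have := hx.ne hab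
    simp only [Set.mem_singleton_iff, Sym2.eq_iff, not_or, not_and]
    exact ⟨fun h => absurd h this, fun _ h => hy h⟩

theorem not_both (hG : G.IsAcyclic) (hab : G.Adj a b) (h : Side G a b x) : ¬ Side G b a x := by
  intro h'
  have hb := (SimpleGraph.isAcyclic_iff_forall_adj_isBridge.1 hG) hab
  rw [SimpleGraph.isBridge_iff] at hb
  have h2 := h'.reachable hab.symm
  rw [Sym2.eq_swap] at h2
  exact hb (h2.trans (h.reachable hab).symm)

theorem not_iff (hG : G.IsTree) (hab : G.Adj a b) : ¬ Side G a b x ↔ Side G b a x :=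
  ⟨fun h => (cover hG.connected x).resolve_left h, fun h => not_both hG.isAcyclic hab.symm h⟩

/-- The only edge that leaves a side is the given edge. -/
theorem crossing (hG : G.IsAcyclic) (hab : G.Adj a b) (hx : Side G a b x) (hxy : G.Adj x y)
    (hy : ¬ Side G a b y) : x = b ∧ y = a := by
  have hya : y = a := by
    by_contra h
    exact hy (hx.step hxy h)
  subst hya
  refine ⟨?_, rfl⟩
  by_contra h
  exact not_both hG hab hx (Side.base.step hxy.symm h)

/-- A connected set which avoids `a` and meets a side at `a` lies in this side. -/
theorem of_connected {S : Set V} (hS : (G.induce S).Connected) (ha : a ∉ S) (hx : x ∈ S)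
    (h : Side G a b x) : ∀ y ∈ S, Side G a b y :=
  hS.induction_on_induce hx h fun _ _ _ hy hxy h => h.step hxy (fun e => ha (e ▸ hy))

/-- Running the walk from `c` to `x` backwards puts `c` on the side of `b`, and the only edge from
that side to `a` starts at `b`. -/
theorem eq_of_both (hG : G.IsAcyclic) (hab : G.Adj a b) (hac : G.Adj a c) (h : Side G a b x)
    (h' : Side G a c x) : b = c := by
  have : Side G a b c := by
    induction h' with
    | base => exact h
    | @step x y hx hxy hy ih => exact ih (h.step hxy.symm (hx.ne hac))
  exact (crossing hG hab this hac.symm (not_self hab)).1.symm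

theorem exists_adj (hG : G.Connected) (h : x ≠ a) : ∃ b, G.Adj a b ∧ Side G a b x := by
  refine (hG.induction_on (P := fun x => x = a ∨ ∃ b, G.Adj a b ∧ Side G a b x) (a := a)
    (Or.inl rfl) ?_ x).resolve_left h
  rintro x y hxy h
  by_cases hy : y = a
  · exact Or.inl hy
  · refine Or.inr ?_
    rcases h with rfl | ⟨b, hb, h⟩
    · exact ⟨y, hxy, .base⟩
    · exact ⟨b, hb, h.step hxy hy⟩

/-- The sides beyond `b`, seen from `a`. -/
theorem subset_of_ne (hG : G.IsAcyclic) (hab : G.Adj a b) (hbc : G.Adj b c) (hca : c ≠ a)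
    (h : Side G b c x) : Side G a b x ∧ x ≠ b := by
  refine ⟨?_, h.ne hbc⟩
  induction h with
  | base => exact Side.base.step hbc hca
  | @step x y hx hxy hy ih =>
    refine ih.step hxy ?_
    rintro rfl
    exact hca (eq_of_both hG hbc hab.symm (hx.step hxy hy) .base)

theorem cases_next (h : Side G a b x) : x = b ∨ ∃ c, G.Adj b c ∧ c ≠ a ∧ Side G b c x := by
  induction h with
  | base => exact Or.inl rfl
  | @step x y hx hxy hy ih =>
    by_cases hyb : y = b
    · exact Or.inl hyb
    · refine Or.inr ?_
      rcases ih with rfl | ⟨c, hc, hca, hxc⟩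
      · exact ⟨y, hxy, hy, .base⟩
      · exact ⟨c, hc, hca, hxc.step hxy hyb⟩

end Side

/-! ### Rooted trees -/

/-- A tree with a distinguished vertex. -/
structure RootTree : Type (u + 1) where
  /-- The type of vertices. -/
  Vert : Type u
  /-- The underlying tree. -/
  graph : SimpleGraph Vert
  isTree : graph.IsTree
  /-- The root. -/
  root : Vert

namespace RootTree

/-- Rooted isomorphism. -/
def IsIso (s t : RootTree.{u}) : Prop := ∃ e : s.graph ≃g t.graph, e s.root = t.root

/-- The rooted minor relation. -/
instance : LE RootTree.{u} :=
  ⟨fun s t => ∃ m : MinorModel s.graph t.graph, t.root ∈ m.branch s.root⟩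

/-- Rooted trees that are rooted minors of each other. -/
def Equi (s t : RootTree.{u}) : Prop := s ≤ t ∧ t ≤ s

theorem IsIso.refl (s : RootTree.{u}) : IsIso s s := ⟨SimpleGraph.Iso.refl, rfl⟩

theorem IsIso.symm {s t : RootTree.{u}} : IsIso s t → IsIso t s := by
  rintro ⟨e, h⟩
  exact ⟨e.symm, by rw [← h]; exact e.symm_apply_apply _⟩

theorem IsIso.trans {r s t : RootTree.{u}} : IsIso r s → IsIso s t → IsIso r t := by
  rintro ⟨e, h⟩ ⟨f, h'⟩
  exact ⟨e.trans f, by rw [← h', ← h]; rfl⟩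

theorem IsIso.le {s t : RootTree.{u}} : IsIso s t → s ≤ t := by
  rintro ⟨e, h⟩
  exact ⟨MinorModel.ofIso e, h.symm⟩

instance : Preorder RootTree.{u} where
  le_refl s := (IsIso.refl s).le
  le_trans := by
    rintro r s t ⟨m, hm⟩ ⟨k, hk⟩
    exact ⟨k.comp m, s.root, hm, hk⟩

theorem IsIso.equi {s t : RootTree.{u}} (h : IsIso s t) : Equi s t := ⟨h.le, h.symm.le⟩

theorem Equi.refl (s : RootTree.{u}) : Equi s s := ⟨le_refl _, le_refl _⟩

theorem Equi.symm {s t : RootTree.{u}} (h : Equi s t) : Equi t s := ⟨h.2, h.1⟩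

theorem Equi.trans {r s t : RootTree.{u}} (h : Equi r s) (h' : Equi s t) : Equi r t :=
  ⟨h.1.trans h'.1, h'.2.trans h.2⟩

/-! ### Joining a family of rooted trees at a new root -/

section node

variable {I : Type u} {J : Type u}

/-- The adjacency relation of the tree obtained by joining a family of rooted trees at a new
root. -/
inductive NodeAdj (c : I → RootTree.{u}) :
    Option (Σ i, (c i).Vert) → Option (Σ i, (c i).Vert) → Prop
  | down (i : I) : NodeAdj c none (some ⟨i, (c i).root⟩)
  | up (i : I) : NodeAdj c (some ⟨i, (c i).root⟩) none
  | inner (i : I) {x y : (c i).Vert} (h : (c i).graph.Adj x y) :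
      NodeAdj c (some ⟨i, x⟩) (some ⟨i, y⟩)

/-- The graph obtained by joining a family of rooted trees at a new root. -/
def nodeGraph (c : I → RootTree.{u}) : SimpleGraph (Option (Σ i, (c i).Vert)) where
  Adj := NodeAdj c
  symm := ⟨by
    rintro _ _ (i | i | ⟨i, h⟩)
    · exact .up i
    · exact .down i
    · exact .inner i h.symm⟩
  loopless := ⟨by
    rintro (_ | ⟨i, x⟩) h
    · cases h
    · cases h with
      | inner _ h => exact h.ne rfl⟩

variable {c : I → RootTree.{u}}

theorem nodeGraph_adj_none {x : Option (Σ i, (c i).Vert)} :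
    (nodeGraph c).Adj none x ↔ ∃ i, x = some ⟨i, (c i).root⟩ := by
  constructor
  · rintro (i | _ | _)
    exact ⟨i, rfl⟩
  · rintro ⟨i, rfl⟩
    exact .down i

theorem nodeGraph_adj_some {i : I} {x y : (c i).Vert} :
    (nodeGraph c).Adj (some ⟨i, x⟩) (some ⟨i, y⟩) ↔ (c i).graph.Adj x y := by
  constructor
  · rintro (_ | _ | ⟨_, h⟩)
    exact h
  · exact .inner i

theorem eq_of_nodeGraph_adj {i j : I} {x : (c i).Vert} {y : (c j).Vert}
    (h : (nodeGraph c).Adj (some ⟨i, x⟩) (some ⟨j, y⟩)) : i = j := by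
  cases h; rfl

theorem nodeGraph_isTree (c : I → RootTree.{u}) : (nodeGraph c).IsTree := by
  refine ⟨connected_of_induction none ?_, isAcyclic_of_cuts ?_⟩
  · rintro P h0 hs (_ | ⟨i, x⟩)
    · exact h0
    · exact (c i).isTree.connected.induction_on (P := fun x => P (some ⟨i, x⟩))
        (hs _ _ (.down i) h0) (fun x y h => hs _ _ (.inner i h)) x
  · have h1 : ∀ i, ¬ ((∃ x, (none : Option (Σ i, (c i).Vert)) = some ⟨i, x⟩) ↔
        ∃ x, some (⟨i, (c i).root⟩ : Σ i, (c i).Vert) = some ⟨i, x⟩) := by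
      intro i h
      obtain ⟨x, hx⟩ := h.2 ⟨_, rfl⟩
      exact Option.some_ne_none _ hx.symm
    have h2 : ∀ i x y, (nodeGraph c).Adj x y → (∃ z, x = some ⟨i, z⟩) → ¬ (∃ z, y = some ⟨i, z⟩) →
        s(x, y) = s(none, some ⟨i, (c i).root⟩) := by
      rintro i x y h ⟨z, rfl⟩ hy
      rcases h with _ | _ | ⟨_, h⟩
      · exact Sym2.eq_swap
      · exact absurd ⟨_, rfl⟩ hy
    rintro a b (i | i | @⟨i, x, y, hxy⟩)
    · exact ⟨fun z => ∃ x, z = some ⟨i, x⟩, h1 i, h2 i⟩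
    · exact ⟨fun z => ∃ x, z = some ⟨i, x⟩, fun h => h1 i h.symm, fun x y h hx hy =>
        (h2 i x y h hx hy).trans Sym2.eq_swap⟩
    -- The cut for an inner edge is the side without the root of the branch, so that the edge to the
    -- new root does not cross it.
    · have key : ∀ x y, (c i).graph.Adj x y → ¬ Side (c i).graph x y (c i).root →
          ∃ P : Option (Σ i, (c i).Vert) → Prop, ¬ (P (some ⟨i, x⟩) ↔ P (some ⟨i, y⟩)) ∧
          ∀ p q, (nodeGraph c).Adj p q → P p → ¬ P q →
            s(p, q) = s(some ⟨i, x⟩, some ⟨i, y⟩) := by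
        intro x y hxy hr
        refine ⟨fun z => ∃ w, z = some ⟨i, w⟩ ∧ Side (c i).graph x y w, ?_, ?_⟩
        · intro h
          obtain ⟨w, hw, hs⟩ := h.2 ⟨y, rfl, .base⟩
          simp only [Option.some.injEq, Sigma.mk.injEq, heq_eq_eq, true_and] at hw
          subst hw
          exact Side.not_self hxy hs
        · rintro p q h ⟨w, rfl, hw⟩ hq
          rcases h with _ | _ | @⟨_, _, z, h⟩
          · exact absurd hw hr
          · obtain ⟨rfl, rfl⟩ := Side.crossing (c i).isTree.isAcyclic hxy hw h
              (fun hz => hq ⟨z, rfl, hz⟩)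
            exact Sym2.eq_swap
      by_cases hr : Side (c i).graph x y (c i).root
      · obtain ⟨P, hP, hc⟩ := key y x hxy.symm (Side.not_both (c i).isTree.isAcyclic hxy hr)
        exact ⟨P, fun h => hP h.symm, fun p q h1 h2 h3 => (hc p q h1 h2 h3).trans Sym2.eq_swap⟩
      · exact key x y hxy hr

/-- The rooted tree obtained by joining a family of rooted trees at a new root. -/
def node (c : I → RootTree.{u}) : RootTree.{u} where
  Vert := Option (Σ i, (c i).Vert)
  graph := nodeGraph c
  isTree := nodeGraph_isTree c
  root := none

theorem isIso_node_of_equiv {c : I → RootTree.{u}} {d : J → RootTree.{u}} (σ : I ≃ J)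
    (h : ∀ i, IsIso (c i) (d (σ i))) : IsIso (node c) (node d) := by
  choose e he using h
  have hroot : ∀ (j : I) (y : (c j).Vert), (nodeGraph d).Adj none (some ⟨σ j, e j y⟩) ↔
      (nodeGraph c).Adj none (some ⟨j, y⟩) := by
    intro j y
    rw [nodeGraph_adj_none, nodeGraph_adj_none]
    constructor
    · rintro ⟨i, h⟩
      refine ⟨j, ?_⟩
      obtain ⟨j', rfl⟩ := σ.surjective i
      have h3 := Option.some.inj h
      have h1 : σ j = σ j' := congrArg Sigma.fst h3
      obtain rfl := σ.injective h1
      have h2 : e j y = (d (σ j)).root := eq_of_heq (Sigma.mk.inj h3).2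
      rw [← he, (e j).injective.eq_iff] at h2
      rw [h2]
    · rintro ⟨i, h⟩
      cases h
      exact ⟨σ j, by rw [← he]⟩
  refine ⟨⟨Equiv.optionCongr (Equiv.sigmaCongr σ fun i => (e i).toEquiv), ?_⟩, rfl⟩
  rintro (_ | ⟨i, x⟩) (_ | ⟨j, y⟩)
  · exact iff_of_false (fun h => h.ne rfl) (fun h => h.ne rfl)
  · exact hroot j y
  · exact (SimpleGraph.adj_comm _ _ _).trans ((hroot i x).trans (SimpleGraph.adj_comm _ _ _))
  · constructor
    · intro h
      have h1 : σ i = σ j := eq_of_nodeGraph_adj (c := d) h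
      obtain rfl := σ.injective h1
      have h2 := (nodeGraph_adj_some (c := d)).1 h
      exact .inner i ((e i).map_adj_iff.1 h2)
    · intro h
      obtain rfl := eq_of_nodeGraph_adj (c := c) h
      have h2 := (nodeGraph_adj_some (c := c)).1 h
      exact NodeAdj.inner (c := d) (σ i) ((e i).map_adj_iff.2 h2)

theorem exists_equiv_of_isIso_node {c : I → RootTree.{u}} {d : J → RootTree.{u}}
    (h : IsIso (node c) (node d)) : ∃ σ : I ≃ J, ∀ i, IsIso (c i) (d (σ i)) := by
  have key : ∀ {I J : Type u} {c : I → RootTree.{u}} {d : J → RootTree.{u}}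
      (e : (node c).graph ≃g (node d).graph), e none = none → ∃ σ : I → J, ∀ i,
        e (some ⟨i, (c i).root⟩) = some ⟨σ i, (d (σ i)).root⟩ ∧
        ∀ x, ∃ y, e (some ⟨i, x⟩) = some ⟨σ i, y⟩ := by
    intro I J c d e he
    have h1 : ∀ i, ∃ j, e (some ⟨i, (c i).root⟩) = some ⟨j, (d j).root⟩ := by
      intro i
      have h2 : (nodeGraph d).Adj (e none) (e (some ⟨i, (c i).root⟩)) :=
        e.map_adj_iff.2 (NodeAdj.down i)
      rw [he] at h2
      exact nodeGraph_adj_none.1 h2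
    choose σ hσ using h1
    refine ⟨σ, fun i => ⟨hσ i, ?_⟩⟩
    refine (c i).isTree.connected.induction_on ⟨_, hσ i⟩ ?_
    rintro x y hxy ⟨z, hz⟩
    have h2 : (nodeGraph d).Adj (e (some ⟨i, x⟩)) (e (some ⟨i, y⟩)) :=
        e.map_adj_iff.2 (NodeAdj.inner i hxy)
    rw [hz] at h2
    rcases hy : e (some ⟨i, y⟩) with _ | ⟨j, w⟩
    · rw [← he] at hy
      exact absurd (e.injective hy) (Option.some_ne_none _)
    · rw [hy] at h2
      obtain rfl := eq_of_nodeGraph_adj h2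
      exact ⟨w, rfl⟩
  obtain ⟨e, he⟩ := h
  obtain ⟨σ, hσ⟩ := key e he
  have he' : e.symm none = none := by
    have := congrArg e.symm he
    exact ((e.symm_apply_apply _).symm.trans this).symm
  obtain ⟨τ, hτ⟩ := key e.symm he'
  have h1 : ∀ i, τ (σ i) = i := by
    intro i
    have h2 := (hτ (σ i)).1
    rw [← (hσ i).1] at h2
    have h3 := (e.symm_apply_apply _).symm.trans h2
    exact (congrArg Sigma.fst (Option.some.inj h3)).symm
  have h2 : ∀ j, σ (τ j) = j := by
    intro j
    have h2 := (hσ (τ j)).1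
    rw [← (hτ j).1] at h2
    have h3 := (e.apply_symm_apply _).symm.trans h2
    exact (congrArg Sigma.fst (Option.some.inj h3)).symm
  refine ⟨⟨σ, τ, h1, h2⟩, fun i => ?_⟩
  choose f hf using (hσ i).2
  have finj : Function.Injective f := by
    intro x y hxy
    have h3 : e (some ⟨i, x⟩) = e (some ⟨i, y⟩) := by rw [hf, hf, hxy]
    exact eq_of_heq (Sigma.mk.inj (Option.some.inj (e.injective h3))).2
  have fsurj : Function.Surjective f := by
    intro y
    obtain ⟨x, hx⟩ := (hτ (σ i)).2 y
    obtain ⟨x', hx'⟩ : ∃ x', e.symm (some ⟨σ i, y⟩) = some ⟨i, x'⟩ := by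
      revert x
      rw [h1 i]
      exact fun x hx => ⟨x, hx⟩
    refine ⟨x', ?_⟩
    have h3 := (hf x').symm.trans ((congrArg e hx').symm.trans (e.apply_symm_apply _))
    exact eq_of_heq (Sigma.mk.inj (Option.some.inj h3)).2
  refine ⟨⟨Equiv.ofBijective f ⟨finj, fsurj⟩, ?_⟩, ?_⟩
  · intro x y
    have h3 : (nodeGraph d).Adj (e (some ⟨i, x⟩)) (e (some ⟨i, y⟩)) ↔
      (nodeGraph c).Adj (some ⟨i, x⟩) (some ⟨i, y⟩) := e.map_adj_iff
    rw [hf, hf, nodeGraph_adj_some, nodeGraph_adj_some] at h3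
    exact h3
  · have h3 := (hσ i).1.symm.trans (hf (c i).root)
    have h4 := eq_of_heq (Sigma.mk.inj (Option.some.inj h3)).2
    exact h4.symm

end node

/-! ### The branches of a tree -/

theorem side_connected {V : Type u} (G : SimpleGraph V) (a b : V) :
    (G.induce {x | Side G a b x}).Connected := by
  refine connected_induce_of (a := b) Side.base ?_
  intro P h0 hs x hx
  induction (show Side G a b x from hx) with
  | base => exact h0
  | @step x y h1 h2 h3 ih => exact hs x h1 y (h1.step h2 h3) h2 (ih h1)

/-- The component of a tree minus `a` that contains the neighbour `b`, with root `b`. -/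
def beyond {V : Type u} (G : SimpleGraph V) (hG : G.IsTree) {a b : V} (_hab : G.Adj a b) :
    RootTree.{u} where
  Vert := {x | Side G a b x}
  graph := G.induce {x | Side G a b x}
  isTree := ⟨side_connected G a b, hG.isAcyclic.induce _⟩
  root := ⟨b, Side.base⟩

/-- The branches at the root. -/
def child (t : RootTree.{u}) (i : t.graph.neighborSet t.root) : RootTree.{u} :=
  beyond t.graph t.isTree i.2

theorem isIso_node_child (t : RootTree.{u}) : IsIso (node t.child) t := by
  let f : (node t.child).Vert → t.Vert := fun z => z.elim t.root fun p => p.2.1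
  have hinj : Function.Injective f := by
    rintro (_ | ⟨i, x⟩) (_ | ⟨j, y⟩) h
    · rfl
    · exact absurd h.symm (y.2.ne j.2)
    · exact absurd h (x.2.ne i.2)
    · have h1 : x.1 = y.1 := h
      have h2 := x.2
      rw [h1] at h2
      obtain rfl : i = j := Subtype.ext (Side.eq_of_both t.isTree.isAcyclic i.2 j.2 h2 y.2)
      obtain rfl : x = y := Subtype.ext h1
      rfl
  have hsurj : Function.Surjective f := by
    intro x
    by_cases hx : x = t.root
    · exact ⟨none, hx.symm⟩
    · obtain ⟨b, hb, h⟩ := Side.exists_adj t.isTree.connected hx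
      exact ⟨some ⟨⟨b, hb⟩, ⟨x, h⟩⟩, rfl⟩
  have hroot : ∀ (j : t.graph.neighborSet t.root) (y : (t.child j).Vert),
      t.graph.Adj t.root y.1 ↔ (nodeGraph t.child).Adj none (some ⟨j, y⟩) := by
    intro j y
    rw [nodeGraph_adj_none]
    constructor
    · intro h
      obtain ⟨h1, -⟩ := Side.crossing t.isTree.isAcyclic j.2 y.2 h.symm (Side.not_self j.2)
      refine ⟨j, ?_⟩
      have : y = (t.child j).root := Subtype.ext h1
      rw [this]
    · rintro ⟨i, h⟩
      cases h
      exact j.2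
  refine ⟨⟨Equiv.ofBijective f ⟨hinj, hsurj⟩, ?_⟩, rfl⟩
  rintro (_ | ⟨i, x⟩) (_ | ⟨j, y⟩)
  · exact ⟨fun h => absurd rfl h.ne, fun h => absurd rfl h.ne⟩
  · exact hroot j y
  · exact (SimpleGraph.adj_comm _ _ _).trans ((hroot i x).trans (SimpleGraph.adj_comm _ _ _))
  · constructor
    · intro h
      have h1 : t.graph.Adj x.1 y.1 := h
      obtain rfl : i = j := Subtype.ext (Side.eq_of_both t.isTree.isAcyclic i.2 j.2
        (Side.step x.2 h1 (y.2.ne j.2)) y.2)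
      exact NodeAdj.inner (c := t.child) i h1
    · intro h
      obtain rfl := eq_of_nodeGraph_adj (c := t.child) h
      exact (nodeGraph_adj_some (c := t.child)).1 h

theorem isIso_child_beyond {V : Type u} (G : SimpleGraph V) (hG : G.IsTree) {a b : V}
    (hab : G.Adj a b) (i : (beyond G hG hab).graph.neighborSet (beyond G hG hab).root) :
    ∃ (c : V) (hbc : G.Adj b c), c ≠ a ∧ IsIso ((beyond G hG hab).child i) (beyond G hG hbc) := by
  obtain ⟨⟨c, hc⟩, hi⟩ := i
  have hbc : G.Adj b c := hi
  have hca : c ≠ a := Side.ne hab hc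
  refine ⟨c, hbc, hca, ?_⟩
  have h1 : ∀ x : (beyond G hG hab).Vert, Side (beyond G hG hab).graph ⟨b, Side.base⟩ ⟨c, hc⟩ x →
      Side G b c x.1 := by
    intro x hx
    induction hx with
    | base => exact .base
    | step _ h2 h3 ih => exact ih.step h2 (fun h => h3 (Subtype.ext h))
  have h2 : ∀ x, Side G b c x → ∃ hx : Side G a b x,
      Side (beyond G hG hab).graph ⟨b, Side.base⟩ ⟨c, hc⟩ ⟨x, hx⟩ := by
    intro x hx
    induction hx with
    | base => exact ⟨hc, .base⟩
    | @step x y h2 h3 h4 ih =>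
      obtain ⟨hx, h5⟩ := ih
      have hy := (Side.subset_of_ne hG.isAcyclic hab hbc hca (h2.step h3 h4)).1
      exact ⟨hy, h5.step h3 (fun h => h4 (congrArg Subtype.val h))⟩
  let f : ((beyond G hG hab).child ⟨⟨c, hc⟩, hi⟩).Vert → (beyond G hG hbc).Vert :=
    fun x => ⟨x.1.1, h1 _ x.2⟩
  have hf : Function.Bijective f := by
    constructor
    · intro x y h
      have h3 : (x.1.1 : V) = y.1.1 := congrArg (fun z : (beyond G hG hbc).Vert => z.1) h
      exact Subtype.ext (Subtype.ext h3)
    · intro x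
      obtain ⟨hx, h3⟩ := h2 x.1 x.2
      exact ⟨⟨⟨x.1, hx⟩, h3⟩, rfl⟩
  exact ⟨⟨Equiv.ofBijective f hf, Iff.rfl⟩, rfl⟩

/-! ### Rooted minors between joined trees, branch by branch. -/

section calculus

variable {I J : Type u}

/-- The tree whose root has a single branch. -/
def single (d : RootTree.{u}) : RootTree.{u} := node fun _ : PUnit.{u + 1} => d

/-- A family of rooted trees extended by one more member. -/
def addFam (e : RootTree.{u}) (c : I → RootTree.{u}) : Option I → RootTree.{u} :=
  fun o => o.elim e c

/-- The inclusion of the tree with the single branch `d j`. -/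
def liftVert (d : J → RootTree.{u}) (j : J) :
    Option (Σ _ : PUnit.{u + 1}, (d j).Vert) → Option (Σ j, (d j).Vert) :=
  Option.map fun p => ⟨j, p.2⟩

theorem liftVert_injective (d : J → RootTree.{u}) (j : J) :
    Function.Injective (liftVert d j) := by
  rintro (_ | ⟨_, x⟩) (_ | ⟨_, y⟩) h
  · rfl
  · cases h
  · cases h
  · cases h
    rfl

theorem liftVert_adj {d : J → RootTree.{u}} {j : J}
    {x y : Option (Σ _ : PUnit.{u + 1}, (d j).Vert)} :
    (nodeGraph d).Adj (liftVert d j x) (liftVert d j y) ↔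
      (nodeGraph fun _ : PUnit.{u + 1} => d j).Adj x y := by
  rcases x with _ | ⟨⟨⟩, x⟩ <;> rcases y with _ | ⟨⟨⟩, y⟩
  · exact iff_of_false (fun h => h.ne rfl) (fun h => h.ne rfl)
  · constructor
    · rintro (_ | _ | _)
      exact .down _
    · rintro (_ | _ | _)
      exact .down j
  · constructor
    · rintro (_ | _ | _)
      exact .up _
    · rintro (_ | _ | _)
      exact .up j
  · constructor
    · rintro (_ | _ | ⟨_, h⟩)
      exact .inner _ h
    · rintro (_ | _ | ⟨_, h⟩)
      exact .inner j h

theorem exists_liftVert_of_adj {d : J → RootTree.{u}} {j : J} {x : (d j).Vert}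
    {y : Option (Σ j, (d j).Vert)} (h : (nodeGraph d).Adj (some ⟨j, x⟩) y) :
    ∃ z, y = liftVert d j z := by
  rcases y with _ | ⟨i, y⟩
  · exact ⟨none, rfl⟩
  · obtain rfl := eq_of_nodeGraph_adj h
    exact ⟨some ⟨⟨⟩, y⟩, rfl⟩

theorem exists_some_of_connected {d : J → RootTree.{u}} {S : Set (Option (Σ j, (d j).Vert))}
    (hS : ((nodeGraph d).induce S).Connected) (h0 : none ∉ S) {j : J} {x : (d j).Vert}
    (hx : some ⟨j, x⟩ ∈ S) : ∀ y ∈ S, ∃ z : (d j).Vert, y = some ⟨j, z⟩ := by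
  refine hS.induction_on_induce hx ⟨x, rfl⟩ ?_
  rintro _ - y hy hxy ⟨z, rfl⟩
  rcases y with _ | ⟨i, y⟩
  · exact absurd hy h0
  · obtain rfl := eq_of_nodeGraph_adj hxy
    exact ⟨y, rfl⟩

theorem node_le_of_injective {c : I → RootTree.{u}} {d : J → RootTree.{u}} (χ : I → J)
    (hχ : Function.Injective χ) (h : ∀ i, c i ≤ d (χ i)) : node c ≤ node d := by
  choose m hm using h
  refine ⟨⟨fun x => {y | (x = none ∧ y = none) ∨ ∃ i v w, x = some ⟨i, v⟩ ∧
    y = some ⟨χ i, w⟩ ∧ w ∈ (m i).branch v}, ?_, ?_, ?_⟩, Or.inl ⟨rfl, rfl⟩⟩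
  · rintro (_ | ⟨i, v⟩)
    · refine connected_induce_of (a := none) (Or.inl ⟨rfl, rfl⟩) ?_
      rintro P h0 - b (⟨-, rfl⟩ | ⟨_, _, _, h, -⟩)
      · exact h0
      · cases h
    · obtain ⟨w, hw⟩ := (m i).nonempty_branch v
      refine connected_induce_of (a := some ⟨χ i, w⟩) (Or.inr ⟨i, v, w, rfl, rfl, hw⟩) ?_
      rintro P h0 h1 b (⟨h, -⟩ | ⟨_, _, w', h, rfl, hw'⟩)
      · cases h
      · cases h
        refine ((m i).connected v).induction_on_induce (P := fun w => P (some ⟨χ i, w⟩))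
          hw h0 ?_ w' hw'
        exact fun x hx y hy hxy => h1 _ (Or.inr ⟨i, v, x, rfl, rfl, hx⟩) _
          (Or.inr ⟨i, v, y, rfl, rfl, hy⟩) (NodeAdj.inner (c := d) _ hxy)
  · intro x y hxy
    rw [Set.disjoint_left]
    rintro a (⟨rfl, rfl⟩ | ⟨i, v, w, rfl, rfl, hw⟩) (⟨rfl, h2⟩ | ⟨i', v', w', rfl, h2, hw'⟩)
    · exact hxy rfl
    · cases h2
    · cases h2
    · have h3 := Option.some.inj h2
      obtain rfl := hχ (congrArg Sigma.fst h3)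
      obtain rfl := eq_of_heq (Sigma.mk.inj h3).2
      exact hxy (by rw [(m i).eq_of_mem hw hw'])
  · rintro _ _ (i | i | @⟨i, x, y, hxy⟩)
    · exact ⟨none, Or.inl ⟨rfl, rfl⟩, some ⟨χ i, (d (χ i)).root⟩,
        Or.inr ⟨i, _, _, rfl, rfl, hm i⟩, NodeAdj.down (c := d) _⟩
    · exact ⟨some ⟨χ i, (d (χ i)).root⟩,
        Or.inr ⟨i, _, _, rfl, rfl, hm i⟩, none, Or.inl ⟨rfl, rfl⟩, NodeAdj.up (c := d) _⟩
    · obtain ⟨a, ha, b, hb, hab⟩ := (m i).adj x y hxy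
      exact ⟨_, Or.inr ⟨i, _, a, rfl, rfl, ha⟩, _, Or.inr ⟨i, _, b, rfl, rfl, hb⟩,
        NodeAdj.inner (c := d) _ hab⟩

theorem single_mono {c d : RootTree.{u}} (h : c ≤ d) : single c ≤ single d :=
  node_le_of_injective id Function.injective_id fun _ => h

/-- The piece of the outer root may reach into `d`. That part is handed over to the piece of the
root of `c`, which is adjacent to it. -/
theorem le_of_single_le {c d : RootTree.{u}} (h : single c ≤ single d) : c ≤ d := by
  obtain ⟨m, hm⟩ := h
  have hd : ∀ S : Set (Option (Σ _ : PUnit.{u + 1}, d.Vert)),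
      ((nodeGraph fun _ : PUnit.{u + 1} => d).induce S).Connected → none ∈ S →
      ∀ w : d.Vert, some ⟨⟨⟩, w⟩ ∈ S → ∀ P : d.Vert → Prop, P d.root →
      (∀ x, some ⟨⟨⟩, x⟩ ∈ S → ∀ y, some ⟨⟨⟩, y⟩ ∈ S → d.graph.Adj x y → P x → P y) → P w := by
    intro S hS h0 w hw P hP hs
    refine hS.induction_on_induce (P := fun z => ∀ w, z = some ⟨⟨⟩, w⟩ → P w) h0 ?_ ?_ _ hw w rfl
    · rintro _ h
      cases h
    · rintro x hx _ hy hxy ih y rfl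
      rcases x with _ | ⟨⟨⟩, x⟩
      · cases hxy
        exact hP
      · exact hs x hx y hy (nodeGraph_adj_some.1 hxy) (ih x rfl)
  have hroot : ∀ w : d.Vert, some ⟨⟨⟩, w⟩ ∈ m.branch none → some ⟨⟨⟩, d.root⟩ ∈ m.branch none := by
    intro w hw
    have h1 := (m.connected none).induction_on_induce
      (P := fun z => z = none ∨ some ⟨⟨⟩, d.root⟩ ∈ m.branch none) hm (Or.inl rfl) ?_ _ hw
    · exact h1.resolve_left (by rintro ⟨⟩)
    · rintro x hx y hy hxy (rfl | h)
      · obtain ⟨_, rfl⟩ := nodeGraph_adj_none.1 hxy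
        exact Or.inr hy
      · exact Or.inr h
  have hne : ∀ v : c.Vert, ∀ y ∈ m.branch (some ⟨⟨⟩, v⟩), ∃ w, y = some ⟨⟨⟩, w⟩ := by
    rintro v (_ | ⟨⟨⟩, w⟩) hy
    · cases m.eq_of_mem hy hm
    · exact ⟨w, rfl⟩
  -- The edge between the two pieces either starts at the outer root, so that it ends in `d.root`,
  -- or starts inside `d`, so that the outer piece contains `d.root`. In both cases the merged piece
  -- contains `d.root`.
  obtain ⟨a, ha, b, hb, hab⟩ := m.adj none (some ⟨⟨⟩, c.root⟩) (NodeAdj.down _)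
  obtain ⟨b, rfl⟩ := hne _ b hb
  have hmem : some ⟨⟨⟩, d.root⟩ ∈ m.branch none ∨
      some ⟨⟨⟩, d.root⟩ ∈ m.branch (some ⟨⟨⟩, c.root⟩) := by
    rcases a with _ | ⟨⟨⟩, a⟩
    · cases hab
      exact Or.inr hb
    · exact Or.inl (hroot a ha)
  refine ⟨⟨fun v => {w | some ⟨⟨⟩, w⟩ ∈ m.branch (some ⟨⟨⟩, v⟩) ∨
    v = c.root ∧ some ⟨⟨⟩, w⟩ ∈ m.branch none}, ?_, ?_, ?_⟩, ?_⟩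
  · intro v
    have hv : ∀ P : d.Vert → Prop, (∀ x y, some ⟨⟨⟩, x⟩ ∈ m.branch (some ⟨⟨⟩, v⟩) →
        some ⟨⟨⟩, y⟩ ∈ m.branch (some ⟨⟨⟩, v⟩) → d.graph.Adj x y → P x → P y) →
        ∀ x y, some ⟨⟨⟩, x⟩ ∈ m.branch (some ⟨⟨⟩, v⟩) →
        some ⟨⟨⟩, y⟩ ∈ m.branch (some ⟨⟨⟩, v⟩) → P x → P y := by
      intro P hs x y hx hy hP
      refine (m.connected _).induction_on_induce (P := fun z => ∀ w, z = some ⟨⟨⟩, w⟩ → P w)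
        hx ?_ ?_ _ hy y rfl
      · rintro w h
        cases h
        exact hP
      · rintro p hp _ hq hpq ih q rfl
        obtain ⟨p, rfl⟩ := hne v p hp
        exact hs p q hp hq (nodeGraph_adj_some.1 hpq) (ih p rfl)
    by_cases hvr : v = c.root
    · subst hvr
      refine connected_induce_of (a := b) (Or.inl hb) ?_
      intro P h0 hs w hw
      have h1 : ∀ w, some ⟨⟨⟩, w⟩ ∈ m.branch (some ⟨⟨⟩, c.root⟩) → P w := fun w hw =>
        hv P (fun x y hx hy => hs x (Or.inl hx) y (Or.inl hy)) b w hb hw h0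
      rcases hw with hw | ⟨-, hw⟩
      · exact h1 w hw
      · have h2 : some ⟨⟨⟩, d.root⟩ ∈ m.branch none := hroot w hw
        have h3 : P d.root := by
          rcases a with _ | ⟨⟨⟩, a⟩
          · cases hab
            cases m.eq_of_mem h2 hb
          · have h4 : P a := hs b (Or.inl hb) a (Or.inr ⟨rfl, ha⟩)
              (nodeGraph_adj_some.1 hab.symm) h0
            by_contra h5
            refine hd _ (m.connected none) hm a ha (fun x => ¬ P x) h5 ?_ h4
            exact fun x hx y hy hxy hPx hPy =>
              hPx (hs y (Or.inr ⟨rfl, hy⟩) x (Or.inr ⟨rfl, hx⟩) hxy.symm hPy)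
        exact hd _ (m.connected none) hm w hw P h3
          (fun x hx y hy => hs x (Or.inr ⟨rfl, hx⟩) y (Or.inr ⟨rfl, hy⟩))
    · obtain ⟨y, hy⟩ := m.nonempty_branch (some ⟨⟨⟩, v⟩)
      obtain ⟨y, rfl⟩ := hne v y hy
      refine connected_induce_of (a := y) (Or.inl hy) ?_
      rintro P h0 hs w (hw | ⟨h, -⟩)
      · exact hv P (fun x y hx hy => hs x (Or.inl hx) y (Or.inl hy)) y w hy hw h0
      · exact absurd h hvr
  · intro v v' hvv
    rw [Set.disjoint_left]
    rintro w (h | ⟨rfl, h⟩) (h' | ⟨h2, h'⟩)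
    · cases m.eq_of_mem h h'
      exact hvv rfl
    · cases m.eq_of_mem h h'
    · cases m.eq_of_mem h h'
    · exact hvv h2.symm
  · intro x y hxy
    obtain ⟨p, hp, q, hq, hpq⟩ := m.adj (some ⟨⟨⟩, x⟩) (some ⟨⟨⟩, y⟩) (NodeAdj.inner _ hxy)
    obtain ⟨p, rfl⟩ := hne _ p hp
    obtain ⟨q, rfl⟩ := hne _ q hq
    exact ⟨p, Or.inl hp, q, Or.inl hq, nodeGraph_adj_some.1 hpq⟩
  · rcases hmem with h | h
    · exact Or.inr ⟨rfl, h⟩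
    · exact Or.inl h

/-- A rooted minor model between trees respects their branches. -/
theorem exists_fibers_of_node_le {c : I → RootTree.{u}} {d : J → RootTree.{u}}
    (h : node c ≤ node d) :
    ∃ φ : I → J, ∀ j, node (fun i : {i // φ i = j} => c i) ≤ single (d j) := by
  obtain ⟨m, hm⟩ := h
  -- The root of the target is taken by the piece of the root. All other pieces avoid it, so each
  -- lies in one branch, and pieces of adjacent vertices lie in the same one.
  have h0 : ∀ i v, none ∉ m.branch (some ⟨i, v⟩) := by
    intro i v h
    cases m.eq_of_mem hm h
  have h1 : ∀ i, ∃ j, ∀ v, ∀ y ∈ m.branch (some ⟨i, v⟩), ∃ z : (d j).Vert, y = some ⟨j, z⟩ := by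
    intro i
    obtain ⟨y, hy⟩ := m.nonempty_branch (some ⟨i, (c i).root⟩)
    rcases y with _ | ⟨j, y⟩
    · exact absurd hy (h0 _ _)
    refine ⟨j, fun v => ?_⟩
    refine (c i).isTree.connected.induction_on (P := fun v => ∀ y ∈ m.branch (some ⟨i, v⟩),
      ∃ z : (d j).Vert, y = some ⟨j, z⟩) (a := (c i).root) ?_ ?_ v
    · exact exists_some_of_connected (m.connected _) (h0 _ _) hy
    · intro p q hpq ih
      obtain ⟨a, ha, b, hb, hab⟩ := m.adj _ _ (NodeAdj.inner i hpq)
      obtain ⟨a, rfl⟩ := ih a ha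
      rcases b with _ | ⟨k, b⟩
      · exact absurd hb (h0 _ _)
      obtain rfl := eq_of_nodeGraph_adj hab
      exact exists_some_of_connected (m.connected _) (h0 _ _) hb
  choose φ hφ using h1
  refine ⟨φ, fun j => ?_⟩
  let g : (node fun i : {i // φ i = j} => c i).Vert → (node c).Vert :=
    Option.map fun p => ⟨p.1.1, p.2⟩
  have ginj : Function.Injective g := by
    rintro (_ | ⟨⟨_, _⟩, x⟩) (_ | ⟨⟨_, _⟩, y⟩) h
    · rfl
    · cases h
    · cases h
    · cases h
      rfl
  have hlift : ∀ (i : {i // φ i = j}) v, ∀ y ∈ m.branch (some ⟨i.1, v⟩),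
      ∃ z : (d j).Vert, y = liftVert d j (some ⟨⟨⟩, z⟩) := by
    rintro ⟨i, rfl⟩ v y hy
    exact hφ i v y hy
  -- The piece of the root, cut down to the root and branch `j`, stays connected because branch `j`
  -- can be entered only through the root.
  refine ⟨⟨fun x => {z | liftVert d j z ∈ m.branch (g x)}, ?_, ?_, ?_⟩, hm⟩
  · rintro (_ | ⟨i, v⟩)
    · refine connected_induce_of (a := none) hm ?_
      intro P hP hs b hb
      refine (m.connected none).induction_on_induce
        (P := fun y => ∀ z, liftVert d j z = y → P z) hm ?_ ?_ _ hb b rfl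
      · rintro (_ | z) h
        · exact hP
        · cases h
      · rintro x hx _ hy hxy ih z rfl
        rcases z with _ | ⟨⟨⟩, z⟩
        · exact hP
        · obtain ⟨x, rfl⟩ := exists_liftVert_of_adj hxy.symm
          exact hs x hx _ hy (liftVert_adj.1 hxy) (ih x rfl)
    · obtain ⟨y, hy⟩ := m.nonempty_branch (some ⟨i.1, v⟩)
      obtain ⟨z, rfl⟩ := hlift i v y hy
      refine connected_induce_of (a := some ⟨⟨⟩, z⟩) hy ?_
      intro P hP hs b hb
      refine (m.connected (some ⟨i.1, v⟩)).induction_on_induce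
        (P := fun y => ∀ z, liftVert d j z = y → P z) hy ?_ ?_ _ hb b rfl
      · rintro z' h
        rwa [liftVert_injective _ _ h]
      · rintro x hx _ hy hxy ih z' rfl
        obtain ⟨x, rfl⟩ := hlift i v x hx
        exact hs _ hx _ hy (liftVert_adj.1 hxy) (ih _ rfl)
  · intro x y hxy
    rw [Set.disjoint_left]
    intro z hz hz'
    exact hxy (ginj (m.eq_of_mem hz hz'))
  · have key : ∀ i : {i // φ i = j}, ∃ a ∈ m.branch none, ∃ b ∈ m.branch (some ⟨i.1, (c i).root⟩),
        ∃ a' b', liftVert d j a' = a ∧ liftVert d j b' = b ∧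
        (nodeGraph fun _ : PUnit.{u + 1} => d j).Adj a' b' := by
      intro i
      obtain ⟨a, ha, b, hb, hab⟩ := m.adj _ _ (NodeAdj.down i.1)
      obtain ⟨b, rfl⟩ := hlift i _ b hb
      obtain ⟨a, rfl⟩ := exists_liftVert_of_adj hab.symm
      exact ⟨_, ha, _, hb, a, _, rfl, rfl, liftVert_adj.1 hab⟩
    rintro _ _ (i | i | @⟨i, x, y, hxy⟩)
    · obtain ⟨_, ha, _, hb, a, b, rfl, rfl, hab⟩ := key i
      exact ⟨a, ha, b, hb, hab⟩
    · obtain ⟨_, ha, _, hb, a, b, rfl, rfl, hab⟩ := key i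
      exact ⟨b, hb, a, ha, hab.symm⟩
    · obtain ⟨a, ha, b, hb, hab⟩ := m.adj _ _ (NodeAdj.inner i.1 hxy)
      obtain ⟨a, rfl⟩ := hlift i _ a ha
      obtain ⟨b, rfl⟩ := hlift i _ b hb
      exact ⟨_, ha, _, hb, liftVert_adj.1 hab⟩

/-- Rooted minor models into the branches of a tree can be put together. -/
theorem node_le_of_fibers {c : I → RootTree.{u}} {d : J → RootTree.{u}} (φ : I → J)
    (h : ∀ j, node (fun i : {i // φ i = j} => c i) ≤ single (d j)) : node c ≤ node d := by
  choose m hm using h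
  let g : ∀ j, (node fun i : {i // φ i = j} => c i).Vert → (node c).Vert :=
    fun j => Option.map fun p => ⟨p.1.1, p.2⟩
  let B : (node c).Vert → Set (node d).Vert := fun x =>
    {y | (x = none ∧ y = none) ∨ ∃ j x' z, g j x' = x ∧ liftVert d j z = y ∧ z ∈ (m j).branch x'}
  have hB : ∀ {j x' z}, z ∈ (m j).branch x' → liftVert d j z ∈ B (g j x') :=
    fun h => Or.inr ⟨_, _, _, rfl, rfl, h⟩
  have hg : ∀ j x', g j x' = none → x' = none := by
    rintro j (_ | x') h
    · rfl
    · cases h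
  have hg2 : ∀ j x' i v, g j x' = some ⟨i, v⟩ →
      ∃ e : φ i = j, x' = some ⟨⟨i, e⟩, v⟩ := by
    rintro j (_ | ⟨⟨i', hi'⟩, v'⟩) i v h
    · cases h
    · cases h
      exact ⟨hi', rfl⟩
  refine ⟨⟨B, ?_, ?_, ?_⟩, Or.inl ⟨rfl, rfl⟩⟩
  · rintro (_ | ⟨i, v⟩)
    · refine connected_induce_of (a := none) (Or.inl ⟨rfl, rfl⟩) ?_
      rintro P h0 hs b (⟨-, rfl⟩ | ⟨j, x', z, hx', rfl, hz⟩)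
      · exact h0
      · obtain rfl := hg _ _ hx'
        refine ((m j).connected none).induction_on_induce (P := fun z => P (liftVert d j z))
          (hm j) h0 ?_ z hz
        exact fun x hx y hy hxy => hs _ (hB hx) _ (hB hy) (liftVert_adj.2 hxy)
    · obtain ⟨z, hz⟩ := (m (φ i)).nonempty_branch (some ⟨⟨i, rfl⟩, v⟩)
      refine connected_induce_of (a := liftVert d (φ i) z) (hB hz) ?_
      rintro P h0 hs b (⟨h, -⟩ | ⟨j, x', z', hx', rfl, hz'⟩)
      · cases h
      · obtain ⟨rfl, rfl⟩ := hg2 _ _ _ _ hx'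
        refine ((m (φ i)).connected _).induction_on_induce
          (P := fun z => P (liftVert d (φ i) z)) hz h0 ?_ z' hz'
        exact fun x hx y hy hxy => hs _ (hB hx) _ (hB hy) (liftVert_adj.2 hxy)
  · have hnone : ∀ j x' z, liftVert d j z = none → z ∈ (m j).branch x' → x' = none := by
      rintro j x' (_ | z) h hz
      · exact (m j).eq_of_mem hz (hm j)
      · cases h
    intro x y hxy
    rw [Set.disjoint_left]
    rintro a (⟨rfl, rfl⟩ | ⟨j, x', z, rfl, rfl, hz⟩) (⟨rfl, h2⟩ | ⟨j', x'', z', rfl, h2, hz'⟩)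
    · exact hxy rfl
    · obtain rfl := hnone _ _ _ h2 hz'
      exact hxy rfl
    · obtain rfl := hnone _ _ _ h2 hz
      exact hxy rfl
    · rcases z with _ | ⟨⟨⟩, z⟩
      · obtain rfl := hnone _ _ _ rfl hz
        obtain rfl := hnone _ _ _ h2 hz'
        exact hxy rfl
      · rcases z' with _ | ⟨⟨⟩, z'⟩
        · cases h2
        · cases h2
          rw [(m j).eq_of_mem hz hz'] at hxy
          exact hxy rfl
  · rintro _ _ (i | i | @⟨i, x, y, hxy⟩)
    · obtain ⟨a, ha, b, hb, hab⟩ := (m (φ i)).adj _ _ (NodeAdj.down ⟨i, rfl⟩)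
      exact ⟨_, hB ha, _, hB hb, liftVert_adj.2 hab⟩
    · obtain ⟨a, ha, b, hb, hab⟩ := (m (φ i)).adj _ _ (NodeAdj.up ⟨i, rfl⟩)
      exact ⟨_, hB ha, _, hB hb, liftVert_adj.2 hab⟩
    · obtain ⟨a, ha, b, hb, hab⟩ := (m (φ i)).adj _ _
        (NodeAdj.inner (c := fun i' : {i' // φ i' = φ i} => c i') ⟨i, rfl⟩ hxy)
      exact ⟨_, hB ha, _, hB hb, liftVert_adj.2 hab⟩

end calculus

/-- Infinitely many pairwise non-isomorphic rooted trees are equivalent to `t`. -/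
def ManyTypes (t : RootTree.{u}) : Prop :=
  ∃ s : ℕ → RootTree.{u}, (∀ n, Equi (s n) t) ∧ ∀ n k, n ≠ k → ¬ IsIso (s n) (s k)

/-- The isomorphism types of rooted trees equivalent to `t` are one or infinitely many. -/
def Dichotomy (t : RootTree.{u}) : Prop :=
  (∀ s, Equi s t → IsIso s t) ∨ ManyTypes t

theorem ManyTypes.congr {s t : RootTree.{u}} (h : Equi s t) : ManyTypes s → ManyTypes t := by
  rintro ⟨r, h1, h2⟩
  exact ⟨r, fun n => (h1 n).trans h, h2⟩

theorem Dichotomy.congr {s t : RootTree.{u}} (h : Equi s t) : Dichotomy s → Dichotomy t := by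
  rintro (h1 | h1)
  · exact Or.inl fun r hr => (h1 r (hr.trans h.symm)).trans (h1 t h.symm).symm
  · exact Or.inr (h1.congr h)

/-! ### Counting branches up to equivalence, and absorbing further copies. -/

variable {I J : Type u}

/-- The number of members of a family that are equivalent to `e`. -/
noncomputable def count (e : RootTree.{u}) (c : I → RootTree.{u}) : Cardinal.{u} :=
  #{i // Equi (c i) e}

theorem count_eq_of_isIso (e : RootTree.{u}) {c : I → RootTree.{u}} {d : J → RootTree.{u}}
    (h : IsIso (node c) (node d)) : count e c = count e d := by
  obtain ⟨σ, hσ⟩ := exists_equiv_of_isIso_node h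
  exact Cardinal.mk_congr (σ.subtypeEquiv fun i =>
    ⟨fun h => (hσ i).symm.equi.trans h, fun h => (hσ i).equi.trans h⟩)

theorem count_addFam (e : RootTree.{u}) (c : I → RootTree.{u}) :
    count e (addFam e c) = count e c + 1 := by
  unfold count
  rw [← Cardinal.mk_option]
  refine Cardinal.mk_congr ?_
  refine ⟨fun o => match o with
    | ⟨none, _⟩ => none
    | ⟨some i, h⟩ => some ⟨i, h⟩, fun o => match o with
    | none => ⟨none, Equi.refl e⟩
    | some i => ⟨some i.1, i.2⟩, ?_, ?_⟩
  · rintro ⟨_ | i, h⟩ <;> rfl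
  · rintro (_ | i) <;> rfl

/-! ### Calculus of families -/

theorem fiber_le_single {c : I → RootTree.{u}} {p : I → Prop} {e : RootTree.{u}}
    (h1 : ∀ i i', p i → p i' → i = i') (h2 : ∀ i, p i → c i ≤ e) :
    node (fun i : {i // p i} => c i) ≤ single e :=
  node_le_of_injective (d := fun _ : PUnit.{u + 1} => e) (fun _ => ⟨⟩)
    (fun i i' _ => Subtype.ext (h1 i i' i.2 i'.2)) (fun i => h2 i i.2)

/-- Only one branch of the fibre is kept; the common root is then removed by `le_of_single_le`. -/
theorem le_of_fibers {c : I → RootTree.{u}} {d : J → RootTree.{u}} {φ : I → J}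
    (h : ∀ j, node (fun i : {i // φ i = j} => c i) ≤ single (d j)) (i : I) : c i ≤ d (φ i) := by
  refine le_of_single_le (le_trans ?_ (h (φ i)))
  exact node_le_of_injective (fun _ : PUnit => (⟨i, rfl⟩ : {i' // φ i' = φ i}))
    (fun _ _ _ => rfl) fun _ => le_refl _

theorem pair_le_of_fibers {c : I → RootTree.{u}} {d : J → RootTree.{u}} {φ : I → J}
    (h : ∀ j, node (fun i : {i // φ i = j} => c i) ≤ single (d j)) {a b : I} (hab : a ≠ b)
    (hφ : φ a = φ b) {e v : RootTree.{u}} (he : e ≤ c a) (hv : v ≤ c b) :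
    node (addFam e fun _ : PUnit.{u + 1} => v) ≤ single (d (φ b)) := by
  refine le_trans ?_ (h (φ b))
  refine node_le_of_injective (fun o : Option PUnit => o.elim ⟨a, hφ⟩ fun _ => ⟨b, rfl⟩) ?_ ?_
  · rintro (_ | _) (_ | _) h
    · rfl
    · exact absurd (congrArg Subtype.val h) hab
    · exact absurd (congrArg Subtype.val h).symm hab
    · rfl
  · rintro (_ | _)
    · exact he
    · exact hv

theorem addFam_mono {c : I → RootTree.{u}} {d : J → RootTree.{u}} (e : RootTree.{u})
    (h : node c ≤ node d) : node (addFam e c) ≤ node (addFam e d) := by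
  obtain ⟨φ, hφ⟩ := exists_fibers_of_node_le h
  refine node_le_of_fibers (Option.map φ) ?_
  rintro (_ | j)
  · refine fiber_le_single (e := e) ?_ ?_
    · rintro (_ | i) (_ | i') h h'
      · rfl
      · cases h'
      · cases h
      · cases h
    · rintro (_ | i) h
      · exact le_refl _
      · cases h
  · refine le_trans ?_ (hφ j)
    have hs : ∀ o : {o // Option.map φ o = some j}, ∃ i : {i // φ i = j}, o.1 = some i.1 := by
      rintro ⟨_ | i, h⟩
      · cases h
      · exact ⟨⟨i, Option.some.inj h⟩, rfl⟩
    choose f hf using hs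
    refine node_le_of_injective f ?_ ?_
    · intro o o' h
      exact Subtype.ext (by rw [hf, hf, h])
    · intro o
      rw [hf]
      exact le_refl _

theorem le_addFam (e : RootTree.{u}) (c : I → RootTree.{u}) : node c ≤ node (addFam e c) :=
  node_le_of_injective some (Option.some_injective _) fun _ => le_refl _

/-- The new branch `e` shares the place of branch `i`, and all other branches stay where they are.
-/
theorem addFam_le_of_pair {c : I → RootTree.{u}} {e : RootTree.{u}} (i : I)
    (h : node (addFam e fun _ : PUnit.{u + 1} => c i) ≤ single (c i)) :
    node (addFam e c) ≤ node c := by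
  refine node_le_of_fibers (fun o : Option I => o.elim i id) fun j => ?_
  by_cases hj : j = i
  · subst hj
    refine le_trans ?_ h
    refine node_le_of_injective (fun o => o.1.map fun _ => ⟨⟩) ?_ ?_
    · rintro ⟨_ | o, ho⟩ ⟨_ | o', ho'⟩ h
      · rfl
      · cases h
      · cases h
      · obtain rfl : o = j := ho
        obtain rfl : o' = o := ho'
        rfl
    · rintro ⟨_ | o, ho⟩
      · exact le_refl _
      · obtain rfl : o = j := ho
        exact le_refl _
  · refine fiber_le_single ?_ ?_
    · rintro (_ | o) (_ | o') h h'
      · rfl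
      · exact absurd h.symm hj
      · exact absurd h'.symm hj
      · exact congrArg some (h.trans h'.symm)
    · rintro (_ | o) h
      · exact absurd h.symm hj
      · obtain rfl : o = j := h
        exact le_refl _

/-! ### Families that absorb another copy of a tree -/

/-- Copies of `e` can be added repeatedly within the class. The count of `e` is an isomorphism
invariant, and as it starts finite, each addition changes it. -/
theorem manyTypes_of_addFam_le {c : I → RootTree.{u}} {e : RootTree.{u}}
    (h : node (addFam e c) ≤ node c) (hc : count e c < ℵ₀) : ManyTypes (node c) := by
  have key : ∀ n : ℕ, ∃ (K : Type u) (f : K → RootTree.{u}), Equi (node f) (node c) ∧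
      node (addFam e f) ≤ node f ∧ count e f = count e c + n := by
    intro n
    induction n with
    | zero => exact ⟨I, c, Equi.refl _, h, by simp⟩
    | succ n ih =>
      obtain ⟨K, f, h1, h2, h3⟩ := ih
      refine ⟨_, addFam e f, ⟨h2.trans h1.1, h1.2.trans (le_addFam e f)⟩, addFam_mono e h2, ?_⟩
      rw [count_addFam, h3, Nat.cast_succ, add_assoc]
  choose K f h1 h2 h3 using key
  refine ⟨fun n => node (f n), h1, fun n k hnk hiso => hnk ?_⟩
  have h4 := count_eq_of_isIso e hiso
  rw [h3, h3] at h4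
  obtain ⟨m, hm⟩ := Cardinal.lt_aleph0.1 hc
  rw [hm] at h4
  have h5 : m + n = m + k := by exact_mod_cast h4
  omega

/-- A Hilbert hotel argument along the orbit of a branch under the round trip from `c` to `d` and
back. -/
theorem addFam_le_of_count_lt {c : I → RootTree.{u}} {d : J → RootTree.{u}} {e : RootTree.{u}}
    (hcd : node c ≤ node d) (hdc : node d ≤ node c) (hlt : count e c < count e d) :
    node (addFam e c) ≤ node c := by
  classical
  obtain ⟨φ, hφ⟩ := exists_fibers_of_node_le hcd
  obtain ⟨ψ, hψ⟩ := exists_fibers_of_node_le hdc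
  -- The class of `e` has too few members in `c` to cover its members in `d`.
  obtain ⟨j₀, hj₀, hnot⟩ : ∃ j, Equi (d j) e ∧ ∀ i, Equi (c i) e → φ i ≠ j := by
    by_contra! hcon
    choose f hf hf' using hcon
    refine hlt.not_ge (Cardinal.mk_le_of_injective
      (f := fun j : {j // Equi (d j) e} => (⟨f j j.2, hf j j.2⟩ : {i // Equi (c i) e})) ?_)
    intro j j' h
    have h1 : f j j.2 = f j' j'.2 := congrArg Subtype.val h
    exact Subtype.ext (by rw [← hf' j j.2, ← hf' j' j'.2, h1])
  have hc : ∀ i, c i ≤ d (φ i) := le_of_fibers hφ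
  have hd : ∀ j, d j ≤ c (ψ j) := le_of_fibers hψ
  have hpair : ∀ a b, a ≠ b → ψ (φ a) = ψ (φ b) → ∀ e v, e ≤ c a → v ≤ c b →
      node (addFam e fun _ : PUnit.{u + 1} => v) ≤ single (c (ψ (φ b))) := by
    intro a b hab h e v he hv
    by_cases hφab : φ a = φ b
    · exact (pair_le_of_fibers hφ hab hφab he hv).trans (single_mono (hd _))
    · exact pair_le_of_fibers hψ hφab h (he.trans (hc a)) (hv.trans (hc b))
  let x : ℕ → I := fun n => (fun i => ψ (φ i))^[n] (ψ j₀)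
  have hx0 : x 0 = ψ j₀ := rfl
  have hxs : ∀ n, x (n + 1) = ψ (φ (x n)) := fun n => Function.iterate_succ_apply' _ _ _
  have hxe : Monotone fun n => c (x n) := monotone_nat_of_le_succ fun n => by
    rw [hxs]
    exact (hc _).trans (hd _)
  have he0 : e ≤ c (x 0) := hj₀.2.trans (hd j₀)
  have hen : ∀ n, e ≤ c (x n) := fun n => he0.trans (hxe (Nat.zero_le n))
  by_cases hinj : Function.Injective x
  -- Along an injective orbit every branch moves one place on, which frees `x 0` for the new copy of
  -- `e`.
  · let f : I → I := fun k => if h : ∃ n, x n = k then x (h.choose + 1) else k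
    have hf1 : ∀ n, f (x n) = x (n + 1) := by
      intro n
      have h : ∃ m, x m = x n := ⟨n, rfl⟩
      have h1 : f (x n) = x (h.choose + 1) := dif_pos h
      rw [h1, hinj h.choose_spec]
    have hf2 : ∀ k, (¬ ∃ n, x n = k) → f k = k := fun k h => dif_neg h
    refine node_le_of_injective (fun o : Option I => o.elim (x 0) f) ?_ ?_
    · have h0 : ∀ k, x 0 ≠ f k := by
        intro k h
        by_cases hk : ∃ n, x n = k
        · obtain ⟨n, rfl⟩ := hk
          rw [hf1] at h
          exact absurd (hinj h) (by omega)
        · rw [hf2 k hk] at h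
          exact hk ⟨0, h⟩
      rintro (_ | k) (_ | l) h
      · rfl
      · exact absurd h (h0 l)
      · exact absurd h.symm (h0 k)
      · have h : f k = f l := h
        by_cases hk : ∃ n, x n = k <;> by_cases hl : ∃ n, x n = l
        · obtain ⟨n, rfl⟩ := hk
          obtain ⟨m, rfl⟩ := hl
          rw [hf1, hf1] at h
          have := hinj h
          rw [show n = m by omega]
        · obtain ⟨n, rfl⟩ := hk
          rw [hf1, hf2 l hl] at h
          exact absurd ⟨_, h⟩ hl
        · obtain ⟨n, rfl⟩ := hl
          rw [hf1, hf2 k hk] at h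
          exact absurd ⟨_, h.symm⟩ hk
        · rw [hf2 k hk, hf2 l hl] at h
          rw [h]
    · rintro (_ | k)
      · exact he0
      · change c k ≤ c (f k)
        by_cases hk : ∃ n, x n = k
        · obtain ⟨n, rfl⟩ := hk
          rw [hf1]
          exact hxe (Nat.le_succ n)
        · rw [hf2 k hk]
  -- At the first vertex of the orbit that recurs, two different predecessors are packed into one
  -- branch; one is at least `e`, the other at least `c (x N)`. So that branch absorbs `e`.
  · have hex : ∃ N p, x N = x (N + p + 1) := by
      rw [Function.Injective] at hinj
      push Not at hinj
      obtain ⟨a, b, h, hab⟩ := hinj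
      rcases lt_or_gt_of_ne hab with hlt | hlt
      · exact ⟨a, b - a - 1, by rw [h]; congr 1; omega⟩
      · exact ⟨b, a - b - 1, by rw [← h]; congr 1; omega⟩
    obtain ⟨p, hp⟩ := Nat.find_spec hex
    have hmin := fun m => Nat.find_min hex (m := m)
    set N := Nat.find hex with hN
    clear_value N
    rw [hxs] at hp
    refine addFam_le_of_pair (x N) ?_
    have hle : c (x N) ≤ c (x (N + p)) := hxe (Nat.le_add_right N p)
    rcases N with _ | N
    -- For `N = 0` the missing predecessor is replaced by `j₀`. It differs from the other one:
    -- otherwise a branch equivalent to `e` would be sent to `j₀`.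
    · by_cases hj : j₀ = φ (x (0 + p))
      · exfalso
        refine hnot (x (0 + p)) ⟨?_, hen _⟩ hj.symm
        refine (hc _).trans ?_
        rw [← hj]
        exact hj₀.1
      · have h1 := pair_le_of_fibers hψ (a := j₀) hj (hx0.symm.trans hp) hj₀.2
          (hle.trans (hc _))
        rw [← hp] at h1
        exact h1
    · have h1 := hpair (x N) (x (N + 1 + p)) (fun h => hmin N (Nat.lt_succ_self N)
        ⟨p, by rw [h]; congr 1; omega⟩) ((hxs N).symm.trans hp) e _ (hen N) hle
      rw [← hp] at h1
      exact h1

/-- The infinitely many branches equivalent to `e` are collapsed to a single one, which makes the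
count finite without leaving the class. -/
theorem le_of_aleph0_le_count {c : I → RootTree.{u}} {d : J → RootTree.{u}} {e : RootTree.{u}}
    (hcd : node c ≤ node d) (hdc : node d ≤ node c) (hc : ℵ₀ ≤ count e c)
    (hlt : count e c < count e d) :
    node c ≤ node (addFam e fun i : {i // ¬ Equi (c i) e} => c i) := by
  classical
  obtain ⟨ψ, hψ⟩ := exists_fibers_of_node_le hdc
  by_cases hα : ∃ i, Equi (c i) e ∧ count e c ≤ #{j : {j // Equi (d j) e} // ψ j = i}
  · obtain ⟨i, hi, hle⟩ := hα
    obtain ⟨g⟩ := hle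
    -- Here one copy of `e` already has room for as many copies of `e` as `c` contains, so all of
    -- them go into the added branch.
    refine node_le_of_fibers (fun k => if h : Equi (c k) e then none else some ⟨k, h⟩) ?_
    have h1 : ∀ k, (if h : Equi (c k) e then (none : Option {i // ¬ Equi (c i) e})
        else some ⟨k, h⟩) = none → Equi (c k) e := by
      intro k hk
      by_contra h
      rw [dif_neg h] at hk
      cases hk
    have h2 : ∀ k j, (if h : Equi (c k) e then (none : Option {i // ¬ Equi (c i) e})
        else some ⟨k, h⟩) = some j → k = j.1 := by
      intro k j hk
      by_cases h : Equi (c k) e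
      · rw [dif_pos h] at hk
        cases hk
      · rw [dif_neg h] at hk
        cases hk
        rfl
    rintro (_ | j)
    · refine le_trans ?_ ((hψ i).trans (single_mono hi.1))
      refine node_le_of_injective (fun k => ⟨(g ⟨k.1, h1 _ k.2⟩).1.1, (g ⟨k.1, h1 _ k.2⟩).2⟩) ?_ ?_
      · intro k k' h
        have h4 : (g ⟨k.1, h1 _ k.2⟩).1.1 = (g ⟨k'.1, h1 _ k'.2⟩).1.1 := Subtype.mk.inj h
        have h3 := g.injective (Subtype.ext (Subtype.ext h4))
        exact Subtype.ext (Subtype.mk.inj h3)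
      · intro k
        exact (h1 _ k.2).1.trans (g ⟨k.1, h1 _ k.2⟩).1.2.2
    · refine fiber_le_single ?_ ?_
      · intro k k' h h'
        rw [h2 k j h, h2 k' j h']
      · intro k h
        rw [h2 k j h]
        exact le_refl _
  · push Not at hα
    -- Now the branches of `c` equivalent to `e` receive at most `#E * #E = #E` of the branches of
    -- `d` equivalent to `e`. The surplus `E₁` goes to other branches of `c` and has at least `#E`
    -- members.
    let E : Type u := {i // Equi (c i) e}
    let J₁ : Type u := {j // ¬ Equi (c (ψ j)) e}
    let E₁ : Type u := {j : J₁ // Equi (d j) e}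
    let E₂ : Type u := {j : {j // Equi (d j) e} // Equi (c (ψ j)) e}
    have hE₂ : #E₂ ≤ #E := by
      have h1 : #E₂ ≤ #(Σ i : E, {j : {j // Equi (d j) e} // ψ j = i}) :=
        Cardinal.mk_le_of_injective (f := fun j : E₂ => ⟨⟨ψ j.1.1, j.2⟩, ⟨j.1, rfl⟩⟩) (by
          intro j j' h
          have h1 := (Sigma.mk.inj h).1
          have h2 := (Sigma.mk.inj h).2
          have h3 : ψ j.1.1 = ψ j'.1.1 := congrArg Subtype.val h1
          have : ∀ (a b : E) (p : {j : {j // Equi (d j) e} // ψ j = a})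
            (q : {j : {j // Equi (d j) e} // ψ j = b}), a = b → HEq p q → p.1 = q.1 := by
            rintro a b p q rfl h
            rw [eq_of_heq h]
          exact Subtype.ext (this _ _ _ _ h1 h2))
      refine h1.trans ?_
      rw [Cardinal.mk_sigma]
      refine (Cardinal.sum_le_sum _ (fun _ => #E) fun i : E => (hα i.1 i.2).le).trans ?_
      rw [Cardinal.sum_const']
      exact (Cardinal.mul_eq_self hc).le
    have hE₁ : #E ≤ #E₁ := by
      have h1 : count e d ≤ #E₁ + #E₂ := by
        rw [Cardinal.add_def]
        refine Cardinal.mk_le_of_injective (f := fun j : {j // Equi (d j) e} =>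
          if h : Equi (c (ψ j)) e then Sum.inr ⟨j, h⟩ else Sum.inl ⟨⟨j.1, h⟩, j.2⟩) ?_
        intro j j' h
        dsimp only at h
        split_ifs at h with h1 h2 h2
        · exact congrArg Subtype.val (Sum.inr.inj h)
        · have h3 := Sum.inl.inj h
          have h4 : j.1 = j'.1 := congrArg (fun z : E₁ => z.1.1) h3
          exact Subtype.ext h4
      by_contra hcon
      push Not at hcon
      have h2 : #E₁ + #E₂ ≤ #E + #E := add_le_add hcon.le hE₂
      exact hlt.not_ge (h1.trans (h2.trans (Cardinal.add_eq_self hc).le))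
    have hsum : #(E₁ ⊕ E) ≤ #E₁ := by
      rw [Cardinal.mk_sum, Cardinal.lift_id, Cardinal.lift_id,
        Cardinal.add_eq_left (hc.trans hE₁) hE₁]
    obtain ⟨g⟩ := hsum
    refine hcd.trans ?_
    -- Branches of `d` sent into the class of `e` are replaced by their hosts in `c`; these are then
    -- absorbed by the surplus `E₁`, and what is left is sent by `ψ` to branches outside the class.
    refine le_trans (b := node (Sum.elim (fun j : J₁ => d j) fun i : E => c i)) ?_ ?_
    · refine node_le_of_fibers (fun j => if h : Equi (c (ψ j)) e then Sum.inr (⟨ψ j, h⟩ : E)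
        else Sum.inl (⟨j, h⟩ : J₁)) ?_
      rintro (j | i)
      · refine fiber_le_single ?_ ?_
        · have : ∀ k, (if h : Equi (c (ψ k)) e then Sum.inr (⟨ψ k, h⟩ : E)
            else Sum.inl (⟨k, h⟩ : J₁)) = Sum.inl j → k = j.1 := by
            intro k hk
            split_ifs at hk
            cases hk
            rfl
          intro k k' h h'
          rw [this k h, this k' h']
        · intro k hk
          split_ifs at hk
          cases hk
          exact le_refl _
      · have : ∀ k, (if h : Equi (c (ψ k)) e then Sum.inr (⟨ψ k, h⟩ : E)
            else Sum.inl (⟨k, h⟩ : J₁)) = Sum.inr i → ψ k = i.1 := by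
          intro k hk
          split_ifs at hk
          cases hk
          rfl
        refine le_trans ?_ (hψ i.1)
        refine node_le_of_injective (fun k => ⟨k.1, this _ k.2⟩) ?_ fun k => le_refl _
        intro k k' h
        have h4 : k.1 = k'.1 := Subtype.mk.inj h
        exact Subtype.ext h4
    refine le_trans (b := node (fun j : J₁ => d j)) ?_ ?_
    · let χ : J₁ ⊕ E → J₁ := Sum.elim
        (fun j => if h : Equi (d j) e then (g (Sum.inl ⟨j, h⟩)).1 else j)
        (fun i => (g (Sum.inr i)).1)
      have hχ1 : ∀ j (h : Equi (d j.1) e), χ (Sum.inl j) = (g (Sum.inl ⟨j, h⟩)).1 :=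
        fun j h => dif_pos h
      have hχ2 : ∀ j : J₁, ¬ Equi (d j) e → χ (Sum.inl j) = j := fun j h => dif_neg h
      have hχ3 : ∀ i, χ (Sum.inr i) = (g (Sum.inr i)).1 := fun i => rfl
      refine node_le_of_injective χ ?_ ?_
      · rintro (j | i) (j' | i') h
        · by_cases h1 : Equi (d j) e <;> by_cases h2 : Equi (d j') e
          · rw [hχ1 j h1, hχ1 j' h2] at h
            have h3 := Sum.inl.inj (g.injective (Subtype.ext h))
            have h4 : j = j' := congrArg Subtype.val h3
            rw [h4]
          · rw [hχ1 j h1, hχ2 j' h2] at h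
            rw [← h] at h2
            exact absurd (g _).2 h2
          · rw [hχ2 j h1, hχ1 j' h2] at h
            rw [h] at h1
            exact absurd (g _).2 h1
          · rw [hχ2 j h1, hχ2 j' h2] at h
            rw [h]
        · by_cases h1 : Equi (d j) e
          · rw [hχ1 j h1, hχ3] at h
            cases g.injective (Subtype.ext h)
          · rw [hχ2 j h1, hχ3] at h
            rw [h] at h1
            exact absurd (g _).2 h1
        · by_cases h1 : Equi (d j') e
          · rw [hχ1 j' h1, hχ3] at h
            cases g.injective (Subtype.ext h)
          · rw [hχ2 j' h1, hχ3] at h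
            rw [← h] at h1
            exact absurd (g _).2 h1
        · rw [hχ3, hχ3] at h
          rw [Sum.inr.inj (g.injective (Subtype.ext h))]
      · rintro (j | i)
        · by_cases h1 : Equi (d j) e
          · rw [hχ1 j h1]
            exact h1.1.trans (g _).2.2
          · rw [hχ2 j h1]
            exact le_refl _
        · rw [hχ3]
          exact i.2.1.trans (g _).2.2
    · refine le_trans ?_ (le_addFam e _)
      refine node_le_of_fibers (fun j : J₁ => ⟨ψ j, j.2⟩) fun i => ?_
      refine le_trans ?_ (hψ i.1)
      refine node_le_of_injective (fun k => ⟨k.1.1, congrArg Subtype.val k.2⟩) ?_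
        fun k => le_refl _
      intro k k' h
      have h4 : k.1.1 = k'.1.1 := Subtype.mk.inj h
      exact Subtype.ext (Subtype.ext h4)

/-- An infinite count is first reduced to one. The reduced family absorbs a second copy of `e`,
because two copies fit into the original family. -/
theorem manyTypes_of_count_lt {c : I → RootTree.{u}} {d : J → RootTree.{u}} {e : RootTree.{u}}
    (h : Equi (node c) (node d)) (hlt : count e c < count e d) : ManyTypes (node c) := by
  rcases lt_or_ge (count e c) ℵ₀ with hc | hc
  · exact manyTypes_of_addFam_le (addFam_le_of_count_lt h.1 h.2 hlt) hc
  · have h1 := le_of_aleph0_le_count h.1 h.2 hc hlt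
    obtain ⟨i₀, i₁, hne⟩ : ∃ i₀ i₁ : {i // Equi (c i) e}, i₀ ≠ i₁ := by
      have : Infinite {i // Equi (c i) e} := Cardinal.infinite_iff.2 hc
      exact exists_pair_ne _
    have h2 : node (addFam e (addFam e fun i : {i // ¬ Equi (c i) e} => c i)) ≤ node c := by
      refine node_le_of_injective (fun o => o.elim i₀.1 fun o => o.elim i₁.1 fun i => i.1) ?_ ?_
      · have h3 : ∀ (i : {i // Equi (c i) e}) (j : {i // ¬ Equi (c i) e}), i.1 ≠ j.1 := by
          intro i j h
          exact j.2 (h ▸ i.2)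
        rintro (_ | _ | i) (_ | _ | j) h
        · rfl
        · exact absurd (Subtype.ext h) hne
        · exact absurd h (h3 _ _)
        · exact absurd (Subtype.ext h).symm hne
        · rfl
        · exact absurd h (h3 _ _)
        · exact absurd h.symm (h3 _ _)
        · exact absurd h.symm (h3 _ _)
        · exact congrArg (fun x => some (some x)) (Subtype.ext h)
      · rintro (_ | _ | i)
        · exact i₀.2.2
        · exact i₁.2.2
        · exact le_refl _
    have h3 : ManyTypes (node (addFam e fun i : {i // ¬ Equi (c i) e} => c i)) := by
      refine manyTypes_of_addFam_le (e := e) (h2.trans h1) ?_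
      rw [count_addFam]
      have : IsEmpty {i : {i // ¬ Equi (c i) e} // Equi (c i) e} := ⟨fun i => i.1.2 i.2⟩
      have h4 : count e (fun i : {i // ¬ Equi (c i) e} => c i) = 0 := Cardinal.mk_eq_zero _
      rw [h4, zero_add]
      exact Cardinal.one_lt_aleph0
    exact h3.congr ⟨(le_addFam _ _).trans h2, h1⟩

instance equiSetoid : Setoid RootTree.{u} := ⟨Equi, Equi.refl, Equi.symm, Equi.trans⟩

theorem exists_equiv_of_count_eq {c : I → RootTree.{u}} {d : J → RootTree.{u}}
    (h : ∀ e, count e c = count e d) : ∃ σ : I ≃ J, ∀ i, Equi (c i) (d (σ i)) := by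
  let qc : I → Quotient equiSetoid.{u} := fun i => ⟦c i⟧
  let qd : J → Quotient equiSetoid.{u} := fun j => ⟦d j⟧
  have h1 : ∀ q, Nonempty ({i // qc i = q} ≃ {j // qd j = q}) := by
    intro q
    induction q using Quotient.inductionOn with
    | h e =>
      obtain ⟨f⟩ := Cardinal.eq.1 (h e)
      exact ⟨((Equiv.subtypeEquivRight fun i => Quotient.eq).trans f).trans
        (Equiv.subtypeEquivRight fun j => Quotient.eq).symm⟩
  let f := fun q => (h1 q).some
  refine ⟨((Equiv.sigmaFiberEquiv qc).symm.trans (Equiv.sigmaCongrRight f)).trans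
    (Equiv.sigmaFiberEquiv qd), fun i => ?_⟩
  have h2 : qd (f (qc i) ⟨i, rfl⟩).1 = qc i := (f (qc i) ⟨i, rfl⟩).2
  exact Equi.symm (Quotient.exact h2)

/-- The dichotomy passes from the branches to the tree. -/
theorem dichotomy_node {c : I → RootTree.{u}} (h : ∀ i, Dichotomy (c i)) :
    Dichotomy (node c) := by
  classical
  by_cases hA : ∃ (K L : Type u) (f : K → RootTree.{u}) (g : L → RootTree.{u}) (e : RootTree.{u}),
      Equi (node f) (node c) ∧ Equi (node g) (node c) ∧ count e f < count e g
  · obtain ⟨K, L, f, g, e, hf, hg, hlt⟩ := hA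
    exact Or.inr ((manyTypes_of_count_lt (hf.trans hg.symm) hlt).congr hf)
  push Not at hA
  by_cases hB : ∃ i, ManyTypes (c i)
  · obtain ⟨i, s, hs, hs'⟩ := hB
    -- The whole class of `c i` is replaced at once, so an isomorphism between two of these trees
    -- must match some `s n` with some `s k`.
    refine Or.inr ⟨fun n => node fun k => if Equi (c k) (c i) then s n else c k, ?_, ?_⟩
    · intro n
      constructor
      · refine node_le_of_injective id Function.injective_id fun k => ?_
        split_ifs with hk
        · exact (hs n).1.trans hk.2
        · exact le_refl _
      · refine node_le_of_injective id Function.injective_id fun k => ?_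
        simp only [id]
        split_ifs with hk
        · exact hk.1.trans (hs n).2
        · exact le_refl _
    · intro n k hnk hiso
      obtain ⟨σ, hσ⟩ := exists_equiv_of_isIso_node hiso
      have h1 := hσ i
      rw [if_pos (Equi.refl (c i))] at h1
      split_ifs at h1 with h2
      · exact hs' n k hnk h1
      · exact h2 (h1.symm.equi.trans (hs n))
  · push Not at hB
    refine Or.inl fun s hs => ?_
    have h1 := isIso_node_child s
    have h2 : Equi (node s.child) (node c) := h1.equi.trans hs
    obtain ⟨σ, hσ⟩ := exists_equiv_of_count_eq (c := s.child) (d := c) fun e =>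
      le_antisymm (hA _ _ _ _ e (Equi.refl _) h2) (hA _ _ _ _ e h2 (Equi.refl _))
    exact h1.symm.trans (isIso_node_of_equiv σ fun i =>
      (h (σ i)).resolve_right (hB _) _ (hσ i))

theorem dichotomy_of_child {t : RootTree.{u}} (h : ∀ i, Dichotomy (t.child i)) : Dichotomy t :=
  (dichotomy_node h).congr (isIso_node_child t).equi

end RootTree

/-! ### Branching vertices -/

section branching

variable {V : Type v} {W : Type w} {G : SimpleGraph V} {H : SimpleGraph W}

/-- A vertex with at least three neighbours. -/
def IsBranching (G : SimpleGraph V) (x : V) : Prop :=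
  ∃ a b c, G.Adj x a ∧ G.Adj x b ∧ G.Adj x c ∧ a ≠ b ∧ a ≠ c ∧ b ≠ c

theorem eq_or_eq_of_not_isBranching {x a b y : V} (hx : ¬ IsBranching G x) (ha : G.Adj x a)
    (hb : G.Adj x b) (hab : a ≠ b) (hy : G.Adj x y) : y = a ∨ y = b := by
  by_contra! h
  exact hx ⟨a, b, y, ha, hb, hy, hab, h.1.symm, h.2.symm⟩

/-- After prolonging the path by `b` and `c`, every vertex of `p` has two neighbours on it, hence no
others. -/
theorem mem_of_adj_path_of_not_isBranching {x y : V} (p : G.Walk x y) (hp : p.IsPath) {b c : V}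
    (hb : G.Adj x b) (hb' : b ∉ p.support) (hc : G.Adj y c) (hc' : c ∉ p.support) (hbc : b ≠ c)
    (hbr : ∀ z ∈ p.support, ¬ IsBranching G z) :
    ∀ z ∈ p.support, ∀ n, G.Adj z n → n = b ∨ n = c ∨ n ∈ p.support := by
  induction p generalizing b with
  | nil =>
    intro z hz n hn
    simp only [SimpleGraph.Walk.support_nil, List.mem_singleton] at hz
    subst hz
    rcases eq_or_eq_of_not_isBranching (hbr z (by simp)) hb hc hbc hn with h | h
    · exact Or.inl h
    · exact Or.inr (Or.inl h)
  | @cons x x' y hxx' p ih =>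
    rw [SimpleGraph.Walk.cons_isPath_iff] at hp
    simp only [SimpleGraph.Walk.support_cons, List.mem_cons, not_or] at hb' hc' hbr ⊢
    intro z hz n hn
    rcases hz with rfl | hz
    · have hbx : b ≠ x' := by
        rintro rfl
        exact hb'.2 p.start_mem_support
      rcases eq_or_eq_of_not_isBranching (hbr z (Or.inl rfl)) hb hxx' hbx hn with h | h
      · exact Or.inl h
      · rw [h]
        exact Or.inr (Or.inr (Or.inr p.start_mem_support))
    · rcases ih hp.1 hxx'.symm hp.2 hc hc'.2 (Ne.symm hc'.1)
        (fun z hz => hbr z (Or.inr hz)) z hz n hn with h | h | h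
      · exact Or.inr (Or.inr (Or.inl h))
      · exact Or.inr (Or.inl h)
      · exact Or.inr (Or.inr (Or.inr h))

/-- Without a branching vertex, the piece would be the path between the exits towards two neighbours
of `x`, with no exit left for the third. -/
theorem MinorModel.exists_isBranching (m : MinorModel G H) {x : V} (hx : IsBranching G x) :
    ∃ y ∈ m.branch x, IsBranching H y := by
  by_contra! hno
  obtain ⟨a, b, c, ha, hb, hc, hab, hac, hbc⟩ := hx
  obtain ⟨a₁, ha₁, a₂, ha₂, haa⟩ := m.adj x a ha
  obtain ⟨b₁, hb₁, b₂, hb₂, hbb⟩ := m.adj x b hb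
  obtain ⟨c₁, hc₁, c₂, hc₂, hcc⟩ := m.adj x c hc
  have hna : a₂ ∉ m.branch x := fun h => ha.ne (m.eq_of_mem h ha₂)
  have hnb : b₂ ∉ m.branch x := fun h => hb.ne (m.eq_of_mem h hb₂)
  have hnc : c₂ ∉ m.branch x := fun h => hc.ne (m.eq_of_mem h hc₂)
  obtain ⟨q, hq⟩ := (m.connected x).exists_isPath ⟨a₁, ha₁⟩ ⟨b₁, hb₁⟩
  let p := q.map (SimpleGraph.Embedding.induce (G := H) (m.branch x)).toHom
  have hp : p.IsPath := hq.map Subtype.val_injective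
  have hsub : ∀ z ∈ p.support, z ∈ m.branch x := by
    intro z hz
    rw [SimpleGraph.Walk.support_map, List.mem_map] at hz
    obtain ⟨y, -, rfl⟩ := hz
    exact y.2
  have key := mem_of_adj_path_of_not_isBranching p hp haa (fun h => hna (hsub _ h)) hbb
    (fun h => hnb (hsub _ h)) (fun h => hab (m.eq_of_mem (h ▸ ha₂) hb₂))
    (fun z hz => hno z (hsub z hz))
  have hall : ∀ z ∈ m.branch x, z ∈ p.support := by
    refine (m.connected x).induction_on_induce ha₁ p.start_mem_support ?_
    intro z _ y hy hzy hzp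
    rcases key z hzp y hzy with rfl | rfl | h
    · exact absurd hy hna
    · exact absurd hy hnb
    · exact h
  rcases key c₁ (hall c₁ hc₁) c₂ hcc with h | h | h
  · exact hac (m.eq_of_mem (h ▸ ha₂) hc₂)
  · exact hbc (m.eq_of_mem (h ▸ hb₂) hc₂)
  · exact hnc (hsub _ h)

theorem MinorModel.infinite (m : MinorModel G H) {S : Set V} (hS : S.Infinite) {X : Set W}
    (h : ∀ x ∈ S, ∀ y ∈ m.branch x, y ∈ X) : X.Infinite := by
  choose f hf using m.nonempty_branch
  exact Set.infinite_of_injOn_mapsTo (f := f)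
    (fun x _ y _ hxy => m.eq_of_mem (hf x) (hxy ▸ hf y)) (fun x hx => h x hx _ (hf x)) hS

/-- A model maps the sides of an edge to the sides of an edge. -/
theorem MinorModel.side (m : MinorModel G H) {a b : V} {c d : W}
    (hc : c ∈ m.branch a) (hd : d ∈ m.branch b) (hab : G.Adj a b) {x : V} (hx : Side G a b x) :
    ∀ y ∈ m.branch x, Side H c d y := by
  induction hx with
  | base =>
    exact Side.of_connected (m.connected b) (fun h => hab.ne (m.eq_of_mem hc h)) hd .base
  | @step x y hx hxy hy ih =>
    have hcy : c ∉ m.branch y := fun h => hy (m.eq_of_mem h hc)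
    obtain ⟨p, hp, q, hq, hpq⟩ := m.adj x y hxy
    exact Side.of_connected (m.connected y) hcy hq ((ih p hp).step hpq fun h => hcy (h ▸ hq))

end branching

/-! ### Walks without turning back -/

section walks

variable {V : Type v} {G : SimpleGraph V}

theorem exists_walk_seq {Q : V → V → Prop}
    (h : ∀ p q, G.Adj p q → Q p q → ∃ r, G.Adj q r ∧ r ≠ p ∧ Q q r) {p q : V} (hpq : G.Adj p q)
    (hQ : Q p q) : ∃ x : ℕ → V, x 0 = p ∧ x 1 = q ∧ (∀ n, G.Adj (x n) (x (n + 1))) ∧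
      (∀ n, x (n + 2) ≠ x n) ∧ ∀ n, Q (x n) (x (n + 1)) := by
  choose f hf1 hf2 hf3 using h
  let D := {d : V × V // G.Adj d.1 d.2 ∧ Q d.1 d.2}
  let g : D → D := fun d => ⟨(d.1.2, f _ _ d.2.1 d.2.2), hf1 _ _ _ _, hf3 _ _ _ _⟩
  let s : ℕ → D := fun n => g^[n] ⟨(p, q), hpq, hQ⟩
  have hs : ∀ n, s (n + 1) = g (s n) := fun n => Function.iterate_succ_apply' _ _ _
  have h1 : ∀ n, (s n).1.2 = (s (n + 1)).1.1 := fun n => by rw [hs]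
  refine ⟨fun n => (s n).1.1, rfl, (h1 0).symm, ?_, ?_, ?_⟩
  · intro n
    change G.Adj (s n).1.1 (s (n + 1)).1.1
    rw [← h1]
    exact (s n).2.1
  · intro n
    change (s (n + 2)).1.1 ≠ (s n).1.1
    rw [← h1, hs]
    exact hf2 _ _ (s n).2.1 (s n).2.2
  · intro n
    change Q (s n).1.1 (s (n + 1)).1.1
    rw [← h1]
    exact (s n).2.2

theorem side_of_walk_seq (hG : G.IsAcyclic) {x : ℕ → V} (h1 : ∀ n, G.Adj (x n) (x (n + 1)))
    (h2 : ∀ n, x (n + 2) ≠ x n) (n k : ℕ) : Side G (x n) (x (n + 1)) (x (n + 1 + k)) := by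
  induction k generalizing n with
  | zero => exact .base
  | succ k ih =>
    have := (Side.subset_of_ne hG (h1 n) (h1 (n + 1)) (h2 n) (ih (n + 1))).1
    rwa [show n + 1 + 1 + k = n + 1 + (k + 1) by omega] at this

theorem injective_of_walk_seq (hG : G.IsAcyclic) {x : ℕ → V} (h1 : ∀ n, G.Adj (x n) (x (n + 1)))
    (h2 : ∀ n, x (n + 2) ≠ x n) : Function.Injective x := by
  have key : ∀ n m, n < m → x n ≠ x m := by
    intro n m hnm h
    have := (side_of_walk_seq hG h1 h2 n (m - (n + 1))).ne (h1 n)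
    rw [show n + 1 + (m - (n + 1)) = m by omega] at this
    exact this h.symm
  intro n m h
  rcases lt_trichotomy n m with hlt | heq | hlt
  · exact absurd h (key _ _ hlt)
  · exact heq
  · exact absurd h.symm (key _ _ hlt)

/-- A ray all of whose vertices after the first one have degree two. -/
structure IsBareRay (G : SimpleGraph V) (x : ℕ → V) : Prop where
  injective : Function.Injective x
  adj : ∀ n, G.Adj (x n) (x (n + 1))
  eq_or_eq : ∀ n y, G.Adj (x (n + 1)) y → y = x n ∨ y = x (n + 2)

theorem IsBareRay.side {x : ℕ → V} (h : IsBareRay G x) {y : V} (hy : Side G (x 0) (x 1) y) :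
    ∃ n, y = x (n + 1) := by
  induction hy with
  | base => exact ⟨0, rfl⟩
  | @step y z _ hyz hz ih =>
    obtain ⟨n, rfl⟩ := ih
    rcases h.eq_or_eq n z hyz with rfl | rfl
    · rcases n with _ | n
      · exact absurd rfl hz
      · exact ⟨n, rfl⟩
    · exact ⟨n + 1, rfl⟩

theorem IsBareRay.not_isBranching {x : ℕ → V} (h : IsBareRay G x) {y : V}
    (hy : Side G (x 0) (x 1) y) : ¬ IsBranching G y := by
  obtain ⟨n, rfl⟩ := h.side hy
  rintro ⟨a, b, c, ha, hb, hc, hab, hac, hbc⟩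
  rcases h.eq_or_eq n a ha with rfl | rfl <;> rcases h.eq_or_eq n b hb with rfl | rfl <;>
    rcases h.eq_or_eq n c hc with rfl | rfl <;> simp at hab hac hbc

/-- In a small tree, a condition on directed edges that can always be continued is satisfied at
the beginning of a bare ray. -/
theorem IsSmallTree.exists_isBareRay (hG : IsSmallTree G) {Q : V → V → Prop}
    (h : ∀ p q, G.Adj p q → Q p q → ∃ r, G.Adj q r ∧ r ≠ p ∧ Q q r) {p q : V} (hpq : G.Adj p q)
    (hQ : Q p q) : ∃ x : ℕ → V, IsBareRay G x ∧ Q (x 0) (x 1) := by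
  obtain ⟨x, -, -, h1, h2, h3⟩ := exists_walk_seq h hpq hQ
  have hinj := injective_of_walk_seq hG.isTree.isAcyclic h1 h2
  obtain ⟨M, hM⟩ := hG.bare x ⟨hinj, h1⟩
  refine ⟨fun n => x (M + n), ⟨fun a b hab => ?_, fun n => h1 _, fun n y hy => ?_⟩, h3 M⟩
  · have := hinj hab
    omega
  · have h4 := hM (M + (n + 1)) (by omega)
    have h5 : ({x (M + n), x (M + (n + 2))} : Set V) = G.neighborSet (x (M + (n + 1))) := by
      refine Set.Finite.eq_of_subset_of_encard_le ?_ ?_ ?_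
      · exact Set.toFinite _
      · rintro z (rfl | rfl)
        · exact (h1 (M + n)).symm
        · exact h1 (M + (n + 1))
      · exact h4.le.trans (Set.encard_pair (h2 (M + n)).symm).ge
    have h6 : y ∈ G.neighborSet (x (M + (n + 1))) := hy
    rw [← h5] at h6
    exact h6

end walks

/-! ### The ray as a rooted tree -/

namespace RootTree

/-- The one-way infinite path. -/
def rayGraph : SimpleGraph (ULift.{u} ℕ) where
  Adj a b := a.down + 1 = b.down ∨ b.down + 1 = a.down
  symm := ⟨fun _ _ h => h.symm⟩
  loopless := ⟨fun _ h => by rcases h with h | h <;> omega⟩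

theorem rayGraph_adj {a b : ULift.{u} ℕ} :
    rayGraph.Adj a b ↔ a.down + 1 = b.down ∨ b.down + 1 = a.down := Iff.rfl

/-- The one-way infinite path, rooted at its first vertex. -/
def ray : RootTree.{u} where
  Vert := ULift.{u} ℕ
  graph := rayGraph
  isTree := by
    refine ⟨connected_of_induction ⟨0⟩ ?_, isAcyclic_of_cuts ?_⟩
    · rintro P h0 hs ⟨n⟩
      induction n with
      | zero => exact h0
      | succ n ih => exact hs ⟨n⟩ ⟨n + 1⟩ (Or.inl rfl) ih
    · have key : ∀ n : ℕ, ∃ P : ULift.{u} ℕ → Prop, ¬ (P ⟨n⟩ ↔ P ⟨n + 1⟩) ∧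
          ∀ x y, rayGraph.Adj x y → P x → ¬ P y → s(x, y) = s(⟨n⟩, ⟨n + 1⟩) := by
        intro n
        refine ⟨fun z => z.down ≤ n, by simp, ?_⟩
        rintro ⟨x⟩ ⟨y⟩ h hx hy
        rw [rayGraph_adj] at h
        dsimp only at h hx hy
        obtain rfl : x = n := by omega
        obtain rfl : y = x + 1 := by omega
        rfl
      rintro ⟨a⟩ ⟨b⟩ (h | h)
      · obtain rfl : a + 1 = b := h
        exact key a
      · obtain rfl : b + 1 = a := h
        obtain ⟨P, h1, h2⟩ := key b
        exact ⟨P, fun h => h1 h.symm, fun x y hxy hx hy => (h2 x y hxy hx hy).trans Sym2.eq_swap⟩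
  root := ⟨0⟩

theorem isIso_ray {t : RootTree.{u}} (x : ℕ → t.Vert) (h0 : x 0 = t.root)
    (hinj : Function.Injective x) (hadj : ∀ n, t.graph.Adj (x n) (x (n + 1)))
    (hn0 : ∀ y, t.graph.Adj (x 0) y → y = x 1)
    (hn : ∀ n y, t.graph.Adj (x (n + 1)) y → y = x n ∨ y = x (n + 2)) : IsIso t ray := by
  have hsurj : ∀ y, ∃ n, x n = y := by
    refine t.isTree.connected.induction_on ⟨0, rfl⟩ ?_
    rintro _ y hxy ⟨n, rfl⟩
    rcases n with _ | n
    · exact ⟨1, (hn0 y hxy).symm⟩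
    · rcases hn n y hxy with rfl | rfl
      · exact ⟨n, rfl⟩
      · exact ⟨n + 2, rfl⟩
  have hf : Function.Bijective (fun n : ULift.{u} ℕ => x n.down) :=
    ⟨fun a b h => ULift.ext _ _ (hinj h), fun y => by
      obtain ⟨n, hn⟩ := hsurj y
      exact ⟨⟨n⟩, hn⟩⟩
  refine IsIso.symm ⟨⟨Equiv.ofBijective _ hf, ?_⟩, h0⟩
  rintro ⟨a⟩ ⟨b⟩
  constructor
  · intro h
    have h : t.graph.Adj (x a) (x b) := h
    rcases a with _ | a
    · exact Or.inl (hinj (hn0 _ h)).symm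
    · rcases hn a _ h with h | h
      · exact Or.inr (congrArg (· + 1) (hinj h))
      · exact Or.inl (hinj h).symm
  · rintro (h | h)
    · obtain rfl : a + 1 = b := h
      exact hadj a
    · obtain rfl : b + 1 = a := h
      exact (hadj b).symm

theorem isIso_beyond_of_isBareRay {V : Type u} {G : SimpleGraph V} (hG : G.IsTree) {x : ℕ → V}
    (hx : IsBareRay G x) : IsIso (beyond G hG (hx.adj 0)) ray := by
  have hne : ∀ n, x (n + 2) ≠ x n := fun n h => by
    have := hx.injective h
    omega
  have hs : ∀ n, Side G (x 0) (x 1) (x (n + 1)) := fun n => by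
    have := side_of_walk_seq hG.isAcyclic hx.adj hne 0 n
    rwa [show 0 + 1 + n = n + 1 by omega] at this
  refine isIso_ray (t := beyond G hG (hx.adj 0)) (fun n => ⟨x (n + 1), hs n⟩) rfl ?_ ?_ ?_ ?_
  · intro a b h
    have := hx.injective (Subtype.mk.inj h)
    omega
  · exact fun n => hx.adj (n + 1)
  · rintro ⟨y, hy⟩ h
    rcases hx.eq_or_eq 0 y h with h1 | h1
    · exact absurd h1 (hy.ne (hx.adj 0))
    · exact Subtype.ext h1
  · rintro n ⟨y, hy⟩ h
    rcases hx.eq_or_eq (n + 1) y h with h1 | h1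
    · exact Or.inl (Subtype.ext h1)
    · exact Or.inr (Subtype.ext h1)

/-- An edge with infinitely many vertices ahead can be continued by another such edge; the resulting
walk from the root is the whole tree. -/
theorem isIso_ray_of_not_isBranching {t : RootTree.{u}} [Infinite t.Vert]
    (hbr : ∀ x, ¬ IsBranching t.graph x)
    (hroot : ∀ a b, t.graph.Adj t.root a → t.graph.Adj t.root b → a = b) : IsIso t ray := by
  have hG := t.isTree
  have hcont : ∀ p q, t.graph.Adj p q → {x | Side t.graph p q x}.Infinite →
      ∃ r, t.graph.Adj q r ∧ r ≠ p ∧ {x | Side t.graph q r x}.Infinite := by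
    intro p q hpq hinf
    by_contra! hcon
    have h1 : ∃ r, t.graph.Adj q r ∧ r ≠ p := by
      by_contra! h2
      refine hinf ((Set.finite_singleton q).subset fun x hx => ?_)
      rcases Side.cases_next hx with h | ⟨c, hc, hca, -⟩
      · exact h
      · exact absurd (h2 c hc) hca
    obtain ⟨r, hqr, hrp⟩ := h1
    have h3 := hcon r hqr hrp
    refine hinf ((h3.insert q).subset fun x hx => ?_)
    rcases Side.cases_next hx with h | ⟨c, hc, hca, hcx⟩
    · exact Or.inl h
    · rcases eq_or_eq_of_not_isBranching (hbr q) hpq.symm hqr hrp.symm hc with h | h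
      · exact absurd h hca
      · exact Or.inr (h ▸ hcx)
  obtain ⟨z, hz⟩ := exists_ne t.root
  obtain ⟨q, hq, -⟩ := Side.exists_adj hG.connected hz
  have hinf : {x | Side t.graph t.root q x}.Infinite := by
    intro hfin
    refine Set.infinite_univ ((hfin.insert t.root).subset fun x _ => ?_)
    by_cases hx : x = t.root
    · exact Or.inl hx
    · obtain ⟨b, hb, hxb⟩ := Side.exists_adj hG.connected hx
      exact Or.inr (hroot b q hb hq ▸ hxb)
  obtain ⟨x, hx0, -, h1, h2, -⟩ := exists_walk_seq hcont hq hinf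
  refine isIso_ray x hx0 (injective_of_walk_seq hG.isAcyclic h1 h2) h1 ?_ ?_
  · intro y hy
    refine hroot _ _ (hx0 ▸ hy) (hx0 ▸ h1 0)
  · exact fun n y hy => eq_or_eq_of_not_isBranching (hbr _) (h1 n).symm (h1 (n + 1)) (h2 n).symm hy

theorem mem_of_connected_rayGraph {S : Set (ULift.{u} ℕ)} (hS : (rayGraph.induce S).Connected)
    {a b c : ULift.{u} ℕ} (ha : a ∈ S) (hc : c ∈ S) (hab : a.down ≤ b.down)
    (hbc : b.down ≤ c.down) : b ∈ S := by
  by_contra hb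
  have hne : ∀ x ∈ S, x.down ≠ b.down := fun x hx h => hb (ULift.ext x b h ▸ hx)
  have h1 := hS.induction_on_induce (P := fun x => x.down < b.down) ha
    (lt_of_le_of_ne hab (hne a ha)) (fun x hx y hy hxy h => by
      have := hne x hx
      have := hne y hy
      rw [rayGraph_adj] at hxy
      omega) c hc
  omega

theorem not_isBranching_rayGraph (x : ULift.{u} ℕ) : ¬ IsBranching rayGraph x := by
  rintro ⟨a, b, c, ha, hb, hc, hab, hac, hbc⟩
  rw [rayGraph_adj] at ha hb hc
  have h1 : a.down ≠ b.down := fun h => hab (ULift.ext _ _ h)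
  have h2 : a.down ≠ c.down := fun h => hac (ULift.ext _ _ h)
  have h3 : b.down ≠ c.down := fun h => hbc (ULift.ext _ _ h)
  omega

/-- A connected set of vertices of the ray has at most one upward edge to its complement. -/
theorem eq_of_upward {S : Set (ULift.{u} ℕ)} (hS : (rayGraph.induce S).Connected)
    {a b c d : ULift.{u} ℕ} (ha : a ∈ S) (hb : b ∈ S) (hc : c ∉ S) (hd : d ∉ S)
    (hac : a.down + 1 = c.down) (hbd : b.down + 1 = d.down) : c = d := by
  have h1 : ¬ c.down ≤ b.down := fun h =>
    hc (mem_of_connected_rayGraph hS ha hb (by omega) h)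
  have h2 : ¬ d.down ≤ a.down := fun h =>
    hd (mem_of_connected_rayGraph hS hb ha (by omega) h)
  exact ULift.ext _ _ (by omega)

/-- The piece of the root contains the first vertex of the ray, so it can be left only upwards and
by one edge; hence the root has at most one neighbour. -/
theorem isIso_ray_of_equi {s : RootTree.{u}} (h : Equi s ray) : IsIso s ray := by
  obtain ⟨⟨m, hm⟩, ⟨k, -⟩⟩ := h
  have hinf : Infinite s.Vert := by
    rw [← Set.infinite_univ_iff]
    have : Infinite (ray.{u}).Vert := inferInstanceAs (Infinite (ULift.{u} ℕ))
    exact k.infinite Set.infinite_univ fun _ _ _ _ => Set.mem_univ _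
  refine isIso_ray_of_not_isBranching (fun x hx => ?_) fun a b ha hb => ?_
  · obtain ⟨y, -, hy⟩ := m.exists_isBranching hx
    exact not_isBranching_rayGraph y hy
  · by_contra hab
    have key : ∀ a, s.graph.Adj s.root a → ∃ x ∈ m.branch s.root, ∃ y ∈ m.branch a,
        y ∉ m.branch s.root ∧ x.down + 1 = y.down := by
      intro a ha
      obtain ⟨x, hx, y, hy, hxy⟩ := m.adj _ _ ha
      have hy' : y ∉ m.branch s.root := fun h => ha.ne (m.eq_of_mem h hy)
      refine ⟨x, hx, y, hy, hy', ?_⟩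
      rcases hxy with h | h
      · exact h
      · exact absurd (mem_of_connected_rayGraph (m.connected s.root) hm hx (Nat.zero_le _)
          (by omega)) hy'
    obtain ⟨x, hx, y, hy, hy', hxy⟩ := key a ha
    obtain ⟨x', hx', z, hz, hz', hxz⟩ := key b hb
    have := eq_of_upward (m.connected s.root) hx hx' hy' hz' hxy hxz
    exact hab (m.eq_of_mem hy (this ▸ hz))

/-- Failure of the dichotomy is inherited by some branch, so it would reach a bare ray, where the
dichotomy holds. -/
theorem dichotomy_beyond {V : Type u} {G : SimpleGraph V} (hG : IsSmallTree G) {a b : V}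
    (hab : G.Adj a b) : Dichotomy (beyond G hG.isTree hab) := by
  by_contra hcon
  obtain ⟨x, hx, h, hQ⟩ := hG.exists_isBareRay
    (Q := fun p q => ∃ h : G.Adj p q, ¬ Dichotomy (beyond G hG.isTree h)) (by
      rintro p q - ⟨hpq, h⟩
      have h1 : ∃ i, ¬ Dichotomy ((beyond G hG.isTree hpq).child i) := by
        by_contra! h2
        exact h (dichotomy_of_child h2)
      obtain ⟨i, hi⟩ := h1
      obtain ⟨r, hqr, hrp, hiso⟩ := isIso_child_beyond G hG.isTree hpq i
      exact ⟨r, hqr, hrp, hqr, fun h => hi (h.congr hiso.symm.equi)⟩) hab ⟨hab, hcon⟩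
  have hiso := isIso_beyond_of_isBareRay hG.isTree hx
  exact hQ (Dichotomy.congr hiso.symm.equi (Or.inl fun s hs => isIso_ray_of_equi hs))

/-- The rooted version of the theorem. -/
theorem dichotomy_of_isSmallTree {t : RootTree.{u}} (h : IsSmallTree t.graph) : Dichotomy t :=
  dichotomy_of_child fun i => dichotomy_beyond h i.2

end RootTree

/-! ### Trees without branching vertices -/

section unbranched

variable {V : Type u} {W : Type u} {T : SimpleGraph V} {S : SimpleGraph W}

open RootTree

/-- Injections in both directions force the pieces to be single vertices. An edge of `S` not coming
from `T` is impossible, because the image of `T` stays connected without it. -/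
theorem nonempty_iso_of_finite [Finite V] (hT : T.IsTree) (hS : S.IsTree)
    (h : AreMutualMinors T S) : Nonempty (T ≃g S) := by
  obtain ⟨⟨m⟩, ⟨k⟩⟩ := h
  choose r hr using m.nonempty_branch
  choose q hq using k.nonempty_branch
  have hrinj : Function.Injective r := fun x y hxy => m.eq_of_mem (hr x) (hxy ▸ hr y)
  have hqinj : Function.Injective q := fun x y hxy => k.eq_of_mem (hq x) (hxy ▸ hq y)
  have : Finite W := Finite.of_injective q hqinj
  have hrbij : Function.Bijective r := (Nat.bijective_iff_injective_and_card r).2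
    ⟨hrinj, le_antisymm (Nat.card_le_card_of_injective r hrinj)
      (Nat.card_le_card_of_injective q hqinj)⟩
  have hmem : ∀ x, ∀ y ∈ m.branch x, y = r x := by
    intro x y hy
    obtain ⟨x', rfl⟩ := hrbij.2 y
    rw [m.eq_of_mem hy (hr x')]
  have hadj : ∀ x y, T.Adj x y → S.Adj (r x) (r y) := by
    intro x y hxy
    obtain ⟨a, ha, b, hb, hab⟩ := m.adj x y hxy
    rwa [hmem x a ha, hmem y b hb] at hab
  refine ⟨⟨Equiv.ofBijective r hrbij, ?_⟩⟩
  intro x y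
  refine ⟨fun h => ?_, hadj x y⟩
  have h : S.Adj (r x) (r y) := h
  by_contra hno
  refine Side.not_self h (hT.connected.induction_on (P := fun z => Side S (r x) (r y) (r z))
    (a := y) .base ?_ x)
  intro p z hpz hp
  by_contra hz
  obtain ⟨h1, h2⟩ := Side.crossing hS.isAcyclic h hp (hadj p z hpz) hz
  rw [hrinj h1, hrinj h2] at hpz
  exact hno hpz.symm

theorem isIso_ray_of_leaf [Infinite V] (hT : T.IsTree) (hbr : ∀ x, ¬ IsBranching T x) {r : V}
    (hr : ∀ a b, T.Adj r a → T.Adj r b → a = b) : IsIso ⟨V, T, hT, r⟩ ray := by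
  have : Infinite (RootTree.mk V T hT r).Vert := ‹Infinite V›
  exact isIso_ray_of_not_isBranching (t := ⟨V, T, hT, r⟩) hbr hr

theorem infinite_side_of_no_leaf (hT : T.IsTree)
    (hleaf : ∀ r, ∃ a b, T.Adj r a ∧ T.Adj r b ∧ a ≠ b) {p q : V} (hpq : T.Adj p q) :
    {x | Side T p q x}.Infinite := by
  obtain ⟨x, hx0, hx1, h1, h2, -⟩ := exists_walk_seq (G := T) (Q := fun _ _ => True) (by
    intro p q _ _
    obtain ⟨a, b, ha, hb, hab⟩ := hleaf q
    by_cases h : a = p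
    · exact ⟨b, hb, fun h' => hab (h.trans h'.symm), trivial⟩
    · exact ⟨a, ha, h, trivial⟩) hpq trivial
  have hinj := injective_of_walk_seq hT.isAcyclic h1 h2
  refine Set.infinite_of_injective_forall_mem (f := fun n => x (0 + 1 + n)) ?_ ?_
  · intro a b h
    have := hinj h
    omega
  · intro n
    have := side_of_walk_seq hT.isAcyclic h1 h2 0 n
    rw [hx0] at this
    rw [show x (0 + 1) = q from hx1] at this
    exact this

theorem isIso_beyond_ray (hT : T.IsTree) (hbr : ∀ x, ¬ IsBranching T x)
    (hleaf : ∀ r, ∃ a b, T.Adj r a ∧ T.Adj r b ∧ a ≠ b) {p q : V} (hpq : T.Adj p q) :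
    IsIso (beyond T hT hpq) ray := by
  have : Infinite (beyond T hT hpq).Vert := (infinite_side_of_no_leaf hT hleaf hpq).to_subtype
  refine isIso_ray_of_not_isBranching ?_ ?_
  · rintro x ⟨a, b, c, ha, hb, hc, hab, hac, hbc⟩
    exact hbr x.1 ⟨a.1, b.1, c.1, ha, hb, hc, fun h => hab (Subtype.ext h),
      fun h => hac (Subtype.ext h), fun h => hbc (Subtype.ext h)⟩
  · intro a b ha hb
    by_contra hab
    exact hbr q ⟨p, a.1, b.1, hpq.symm, ha, hb, (Side.ne hpq a.2).symm, (Side.ne hpq b.2).symm,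
      fun h => hab (Subtype.ext h)⟩

theorem ncard_neighborSet_of_no_leaf (hbr : ∀ x, ¬ IsBranching T x)
    (hleaf : ∀ r, ∃ a b, T.Adj r a ∧ T.Adj r b ∧ a ≠ b) (v : V) :
    (T.neighborSet v).ncard = 2 := by
  obtain ⟨a, b, ha, hb, hab⟩ := hleaf v
  rw [Set.ncard_eq_two]
  refine ⟨a, b, hab, Set.Subset.antisymm ?_ ?_⟩
  · exact fun y hy => eq_or_eq_of_not_isBranching (hbr v) ha hb hab hy
  · rintro y (rfl | rfl)
    · exact ha
    · exact hb

/-- Both trees are double rays: a vertex joined to two rays. -/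
theorem nonempty_iso_of_no_leaf (hT : T.IsTree) (hS : S.IsTree)
    (hbrT : ∀ x, ¬ IsBranching T x) (hbrS : ∀ x, ¬ IsBranching S x)
    (hleafT : ∀ r, ∃ a b, T.Adj r a ∧ T.Adj r b ∧ a ≠ b)
    (hleafS : ∀ r, ∃ a b, S.Adj r a ∧ S.Adj r b ∧ a ≠ b) : Nonempty (T ≃g S) := by
  obtain ⟨r⟩ := hT.connected.nonempty
  obtain ⟨s⟩ := hS.connected.nonempty
  have h1 := ncard_neighborSet_of_no_leaf hbrT hleafT r
  have h2 := ncard_neighborSet_of_no_leaf hbrS hleafS s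
  have : Finite (T.neighborSet r) := Set.finite_of_ncard_pos (by omega)
  have : Finite (S.neighborSet s) := Set.finite_of_ncard_pos (by omega)
  obtain ⟨σ⟩ : Nonempty (T.neighborSet r ≃ S.neighborSet s) :=
    Finite.card_eq.1 (h1.trans h2.symm)
  have h3 := isIso_node_child ⟨V, T, hT, r⟩
  have h4 := isIso_node_child ⟨W, S, hS, s⟩
  obtain ⟨e, -⟩ := (h3.symm.trans (isIso_node_of_equiv σ fun i =>
    (isIso_beyond_ray hT hbrT hleafT i.2).trans
      (isIso_beyond_ray hS hbrS hleafS (σ i).2).symm)).trans h4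
  exact ⟨e⟩

/-- A tree without leaves is not a minor of the ray. -/
theorem not_isGraphMinor_ray (hT : T.IsTree)
    (hleaf : ∀ r, ∃ a b, T.Adj r a ∧ T.Adj r b ∧ a ≠ b) : ¬ IsGraphMinor T rayGraph.{u} := by
  rintro ⟨m⟩
  obtain ⟨r⟩ := hT.connected.nonempty
  obtain ⟨a, b, ha, hb, hab⟩ := hleaf r
  have key : ∀ a, T.Adj r a → ∃ x ∈ m.branch r, ∃ y ∈ m.branch a,
      y ∉ m.branch r ∧ x.down + 1 = y.down := by
    intro a ha
    obtain ⟨x, hx, y, hy, hxy⟩ := m.adj _ _ ha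
    refine ⟨x, hx, y, hy, fun h => ha.ne (m.eq_of_mem h hy), ?_⟩
    rcases hxy with h | h
    · exact h
    -- After a downward step, the infinite side beyond `a` would be modelled in a finite initial
    -- segment of the ray.
    · exfalso
      have hfin : {z : ULift.{u} ℕ | z.down ≤ y.down}.Finite :=
        (Set.finite_Iic y.down).preimage ULift.down_injective.injOn
      refine m.infinite (infinite_side_of_no_leaf hT hleaf ha) (fun z hz p hp => ?_) hfin
      have hside : Side rayGraph x y p := m.side hx hy ha hz p hp
      clear hp hz
      induction hside with
      | base => exact le_refl y.down
      | @step p q _ hpq hq ih =>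
        have hq' : q.down ≠ x.down := fun h => hq (ULift.ext _ _ h)
        have ih : p.down ≤ y.down := ih
        change q.down ≤ y.down
        rw [rayGraph_adj] at hpq
        omega
  obtain ⟨x, hx, y, hy, hy', hxy⟩ := key a ha
  obtain ⟨x', hx', z, hz, hz', hxz⟩ := key b hb
  have := eq_of_upward (m.connected r) hx hx' hy' hz' hxy hxz
  exact hab (m.eq_of_mem hy (this ▸ hz))

theorem IsGraphMinor.trans {U V W : Type u} {F : SimpleGraph U} {G : SimpleGraph V}
    {H : SimpleGraph W} : IsGraphMinor F G → IsGraphMinor G H → IsGraphMinor F H :=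
  fun ⟨m⟩ ⟨k⟩ => ⟨k.comp m⟩

theorem nonempty_iso_of_not_isBranching (hT : T.IsTree) (hS : S.IsTree)
    (hbr : ∀ x, ¬ IsBranching T x) (h : AreMutualMinors T S) : Nonempty (T ≃g S) := by
  rcases finite_or_infinite V with hV | hV
  · exact nonempty_iso_of_finite hT hS h
  have hbrS : ∀ x, ¬ IsBranching S x := by
    obtain ⟨k⟩ := h.2
    intro x hx
    obtain ⟨y, -, hy⟩ := k.exists_isBranching hx
    exact hbr y hy
  have hW : Infinite W := by
    obtain ⟨m⟩ := h.1
    rw [← Set.infinite_univ_iff]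
    exact m.infinite Set.infinite_univ fun _ _ _ _ => Set.mem_univ _
  by_cases hlT : ∀ r, ∃ a b, T.Adj r a ∧ T.Adj r b ∧ a ≠ b <;>
    by_cases hlS : ∀ r, ∃ a b, S.Adj r a ∧ S.Adj r b ∧ a ≠ b
  · exact nonempty_iso_of_no_leaf hT hS hbr hbrS hlT hlS
  · push Not at hlS
    obtain ⟨s, hs⟩ := hlS
    obtain ⟨e, -⟩ := isIso_ray_of_leaf hS hbrS hs
    exact absurd (h.1.trans ⟨MinorModel.ofIso e⟩) (not_isGraphMinor_ray hT hlT)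
  · push Not at hlT
    obtain ⟨r, hr⟩ := hlT
    obtain ⟨e, -⟩ := isIso_ray_of_leaf hT hbr hr
    exact absurd (h.2.trans ⟨MinorModel.ofIso e⟩) (not_isGraphMinor_ray hS hlS)
  · push Not at hlT hlS
    obtain ⟨r, hr⟩ := hlT
    obtain ⟨s, hs⟩ := hlS
    obtain ⟨e, -⟩ := (isIso_ray_of_leaf hT hbr hr).trans (isIso_ray_of_leaf hS hbrS hs).symm
    exact ⟨e⟩

end unbranched

/-! ### The order on directed edges -/

namespace SimpleGraph.Dart

variable {V : Type v} {W : Type w} {G : SimpleGraph V} {H : SimpleGraph W}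

/-- The directed edge `f` lies beyond the directed edge `e` and points away from it. -/
def Before (e f : G.Dart) : Prop := Side G e.fst e.snd f.fst ∧ ¬ Side G f.fst f.snd e.fst

/-- There is a branching vertex ahead of the directed edge. -/
def Good (e : G.Dart) : Prop := ∃ x, Side G e.fst e.snd x ∧ IsBranching G x

/-- A model takes the directed edge `e` to the directed edge `f`. -/
def MapsTo (m : MinorModel G H) (e : G.Dart) (f : H.Dart) : Prop :=
  f.fst ∈ m.branch e.fst ∧ f.snd ∈ m.branch e.snd

theorem exists_mapsTo (m : MinorModel G H) (e : G.Dart) : ∃ f, MapsTo m e f := by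
  obtain ⟨a, ha, b, hb, hab⟩ := m.adj _ _ e.adj
  exact ⟨⟨(a, b), hab⟩, ha, hb⟩

theorem MapsTo.symm {m : MinorModel G H} {e : G.Dart} {f : H.Dart} (h : MapsTo m e f) :
    MapsTo m e.symm f.symm := ⟨h.2, h.1⟩

theorem MapsTo.comp {U : Type u} {F : SimpleGraph U} {m : MinorModel G H} {k : MinorModel F G}
    {e : F.Dart} {f : G.Dart} {g : H.Dart} (h : MapsTo k e f) (h' : MapsTo m f g) :
    MapsTo (m.comp k) e g := ⟨⟨_, h.1, h'.1⟩, ⟨_, h.2, h'.2⟩⟩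

theorem MapsTo.side {m : MinorModel G H} {e : G.Dart} {f : H.Dart} (h : MapsTo m e f) {x : V}
    (hx : Side G e.fst e.snd x) : ∀ y ∈ m.branch x, Side H f.fst f.snd y :=
  m.side h.1 h.2 e.adj hx

theorem MapsTo.good {m : MinorModel G H} {e : G.Dart} {f : H.Dart} (h : MapsTo m e f) :
    Good e → Good f := by
  rintro ⟨x, hx, hb⟩
  obtain ⟨y, hy, hby⟩ := m.exists_isBranching hb
  exact ⟨y, h.side hx y hy, hby⟩

theorem MapsTo.before {m : MinorModel G H} (hG : G.IsTree) (hH : H.IsAcyclic) {e e' : G.Dart}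
    {f f' : H.Dart} (h : MapsTo m e f) (h' : MapsTo m e' f') (hb : Before e e') :
    Before f f' := by
  refine ⟨h.side hb.1 _ h'.1, ?_⟩
  have h1 := (Side.not_iff hG e'.adj).1 hb.2
  exact Side.not_both hH f'.adj.symm (h'.symm.side h1 _ h.1)

theorem Before.side {e f : G.Dart} (h : Before e f) {x : V} (hx : Side G f.fst f.snd x) :
    Side G e.fst e.snd x := by
  have hd : Side G e.fst e.snd f.snd := by
    refine h.1.step f.adj fun hs => h.2 ?_
    rw [← hs]
    exact .base
  exact Side.of_connected (RootTree.side_connected G f.fst f.snd) h.2 Side.base hd x hx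

theorem Before.good {e f : G.Dart} (h : Before e f) : Good f → Good e :=
  fun ⟨x, hx, hb⟩ => ⟨x, h.side hx, hb⟩

theorem Before.trans {e f g : G.Dart} (h : Before e f) (h' : Before f g) : Before e g :=
  ⟨h.side h'.1, fun hx => h.2 (h'.side hx)⟩

theorem symm_eq_or_before (hG : G.IsAcyclic) {e f : G.Dart} (h : Side G e.fst e.snd f.fst)
    (h' : Side G f.fst f.snd e.fst) : f.symm = e ∨ Before e f.symm := by
  by_cases hs : Side G e.fst e.snd f.snd
  · exact Or.inr ⟨hs, Side.not_both hG f.adj h'⟩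
  · obtain ⟨h1, h2⟩ := Side.crossing hG e.adj h f.adj hs
    exact Or.inl (SimpleGraph.Dart.ext _ _ (Prod.ext h2 h1))

/-- In a small tree there is no infinite chain of directed edges with branching vertices ahead. -/
theorem false_of_chain (hG : IsSmallTree G) (e : ℕ → G.Dart) (he : ∀ n, Good (e n))
    (hb : ∀ n, Before (e n) (e (n + 1))) : False := by
  -- The walk heads for the edge `e n`, passes through it and then heads for `e (n + 1)`. On a bare
  -- ray nothing branching is ahead, although `e n` is still to come.
  obtain ⟨x, hx, h, n, hn⟩ := hG.exists_isBareRay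
    (Q := fun p q => ∃ (h : G.Adj p q) (n : ℕ), Before ⟨(p, q), h⟩ (e n)) (by
      rintro p q hpq ⟨_, n, h1, h2⟩
      have hvp : (e n).snd ≠ p := by
        rintro rfl
        exact h2 .base
      rcases Side.cases_next h1 with h3 | ⟨r, hqr, hrp, h3⟩
      · have h3 : (e n).fst = q := h3
        have h4 : G.Adj q (e n).snd := by
          rw [← h3]
          exact (e n).adj
        refine ⟨(e n).snd, h4, hvp, h4, n + 1, ?_⟩
        have h5 : (⟨(q, (e n).snd), h4⟩ : G.Dart) = e n :=
          SimpleGraph.Dart.ext _ _ (Prod.ext h3.symm rfl)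
        rw [h5]
        exact hb n
      · refine ⟨r, hqr, hrp, hqr, n, h3, fun h4 => ?_⟩
        obtain ⟨-, h5⟩ := Side.crossing hG.isTree.isAcyclic (e n).adj h4 hpq.symm h2
        exact h1.ne hpq h5.symm) (e 0).adj ⟨(e 0).adj, 1, hb 0⟩
  obtain ⟨y, hy, hby⟩ := hn.good (he n)
  exact hx.not_isBranching hy hby

/-- Iterating `h` would push the edge forward for ever, and `g` carries the resulting chain into the
small tree. -/
theorem not_before_of_mapsTo (hG : IsSmallTree G) (hH : H.IsTree) (g : MinorModel H G)
    (h : MinorModel H H) {e f : H.Dart} (he : Good e) (hef : MapsTo h e f) : ¬ Before e f := by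
  intro hb
  choose F hF using exists_mapsTo h
  let P := {p : H.Dart × H.Dart // Good p.1 ∧ MapsTo h p.1 p.2 ∧ Before p.1 p.2}
  let next : P → P := fun p => ⟨(p.1.2, F p.1.2), p.2.2.1.good p.2.1, hF _,
    p.2.2.1.before hH hH.isAcyclic (hF _) p.2.2.2⟩
  let s : ℕ → P := fun n => next^[n] ⟨(e, f), he, hef, hb⟩
  have hs : ∀ n, s (n + 1) = next (s n) := fun n => Function.iterate_succ_apply' _ _ _
  have hs' : ∀ n, (s (n + 1)).1.1 = (s n).1.2 := fun n => by rw [hs]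
  choose K hK using exists_mapsTo g
  refine false_of_chain hG (fun n => K (s n).1.1) (fun n => (hK _).good (s n).2.1) fun n => ?_
  refine (hK _).before hH hG.isTree.isAcyclic (hK _) ?_
  rw [hs']
  exact (s n).2.2.2

end SimpleGraph.Dart

/-! ### A pivot for the self-models of a small tree -/

section pivot

open SimpleGraph.Dart

variable {V : Type v} {W : Type w} {T : SimpleGraph V} {S : SimpleGraph W}

/-- When each end of an edge can be moved across the edge, these moves must reverse the edge
exactly, and its ends form a pivot. -/
theorem pivot_of_flip (hT : IsSmallTree T) {e : T.Dart} (he : Good e) (he' : Good e.symm)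
    {h₁ h₂ : MinorModel T T} (hh₁ : ∀ z ∈ h₁.branch e.fst, Side T e.fst e.snd z)
    (hh₂ : ∀ z ∈ h₂.branch e.snd, Side T e.snd e.fst z) :
    (∀ h : MinorModel T T, e.fst ∈ h.branch e.fst ∨ e.fst ∈ h.branch e.snd) ∧
      e.snd ∈ h₁.branch e.fst := by
  have hac := hT.isTree.isAcyclic
  have hno : ∀ (h : MinorModel T T) {e f : T.Dart}, Good e → MapsTo h e f → ¬ Before e f :=
    fun h _ _ => not_before_of_mapsTo hT hT.isTree (MinorModel.ofIso SimpleGraph.Iso.refl) h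
  -- The image of `e` starts ahead of `e` and cannot point forward, so its reverse does, unless it
  -- equals `e`.
  have claimA : ∀ (e : T.Dart) (h : MinorModel T T), Good e →
      (∀ z ∈ h.branch e.fst, Side T e.fst e.snd z) →
      ∃ f, MapsTo h e.symm f ∧ (f = e ∨ Before e f) := by
    intro e h he hh
    obtain ⟨f, hf⟩ := exists_mapsTo h e
    have h1 := hh _ hf.1
    by_cases h2 : Side T f.fst f.snd e.fst
    · exact ⟨f.symm, hf.symm, symm_eq_or_before hac h1 h2⟩
    · exact absurd ⟨h1, h2⟩ (hno h he hf)
  -- A strict advance of `f` would make `h'.comp h` push `e.symm` strictly forward.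
  have claimB : ∀ (h h' : MinorModel T T) (f f' : T.Dart), MapsTo h e.symm f →
      (f = e ∨ Before e f) → MapsTo h' e f' → (f' = e.symm ∨ Before e.symm f') → f = e := by
    intro h h' f f' hf hef hf' hef'
    rcases hef with hef | hef
    · exact hef
    · exfalso
      obtain ⟨g, hg⟩ := exists_mapsTo h' f
      have h1 : Before f' g := hf'.before hT.isTree hac hg hef
      refine hno (h'.comp h) he' (hf.comp hg) ?_
      rcases hef' with rfl | h2
      · exact h1
      · exact h2.trans h1
  obtain ⟨f₁, hf₁, hef₁⟩ := claimA e h₁ he hh₁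
  obtain ⟨f₂, hf₂, hef₂⟩ := claimA e.symm h₂ he' hh₂
  obtain rfl : f₁ = e := claimB h₁ h₂ f₁ f₂ hf₁ hef₁ hf₂ hef₂
  refine ⟨fun h => ?_, hf₁.2⟩
  by_contra! hcon
  obtain ⟨z, hz⟩ := h.nonempty_branch f₁.fst
  have hzx : z ≠ f₁.fst := fun hs => hcon.1 (hs ▸ hz)
  obtain ⟨r, hr, hzr⟩ := Side.exists_adj hT.isTree.connected hzx
  have hside := Side.of_connected (h.connected f₁.fst) hcon.1 hz hzr
  by_cases hry : r = f₁.snd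
  · subst hry
    obtain ⟨f, hf, hef⟩ := claimA f₁ h he hside
    obtain rfl := claimB h h₁ f f₁.symm hf hef hf₁.symm (Or.inl rfl)
    exact hcon.2 hf.1
  -- Here the first end is moved away from the edge. Depending on the direction of the image, either
  -- `h` or `h.comp h₁` pushes the reversed edge strictly forward.
  · obtain ⟨f, hf⟩ := exists_mapsTo h f₁
    have h1 : Side T f₁.fst r f.fst := hside _ hf.1
    have hsub : ∀ x, Side T f₁.fst r x → Side T f₁.snd f₁.fst x := fun x hx =>
      (Side.subset_of_ne hac f₁.adj.symm hr hry hx).1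
    by_cases h2 : Side T f.fst f.snd f₁.fst
    · refine hno h he' hf.symm ⟨?_, ?_⟩
      · rcases symm_eq_or_before hac (e := ⟨(f₁.fst, r), hr⟩) h1 h2 with h3 | h3
        · have h4 : f.snd = f₁.fst := congrArg (fun d : T.Dart => d.fst) h3
          change Side T f₁.snd f₁.fst f.snd
          rw [h4]
          exact .base
        · exact hsub _ h3.1
      · refine Side.not_both hac f.adj (h2.step f₁.adj ?_)
        intro h3
        exact (hsub _ h1).ne f₁.adj.symm h3.symm
    · refine hno (h.comp h₁) he' (hf₁.comp hf) ⟨hsub _ h1, fun h3 => ?_⟩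
      obtain ⟨-, h4⟩ := Side.crossing hac f.adj h3 f₁.adj.symm h2
      exact h1.ne hr h4.symm

/-- Without a pivot, every vertex is moved off itself by some self-model, in the direction of some
neighbour. Following these directions never turns back, by `pivot_of_flip`, and always keeps
branching vertices ahead, against smallness. -/
theorem exists_pivot (hT : IsSmallTree T) {b : V} (hb : IsBranching T b) :
    ∃ x y, (∀ h : MinorModel T T, x ∈ h.branch x ∨ x ∈ h.branch y) ∧
      ∃ h : MinorModel T T, y ∈ h.branch x := by
  by_contra hno
  have hac := hT.isTree.isAcyclic
  have hmove : ∀ q, ∃ (h : MinorModel T T) (r : V), T.Adj q r ∧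
      ∀ z ∈ h.branch q, Side T q r z := by
    intro q
    have h1 : ∃ h : MinorModel T T, q ∉ h.branch q := by
      by_contra! h1
      exact hno ⟨q, q, fun h => Or.inl (h1 h), MinorModel.ofIso SimpleGraph.Iso.refl, h1 _⟩
    obtain ⟨h, hq⟩ := h1
    obtain ⟨z, hz⟩ := h.nonempty_branch q
    have hzq : z ≠ q := fun hs => hq (hs ▸ hz)
    obtain ⟨r, hr, hzr⟩ := Side.exists_adj hT.isTree.connected hzq
    exact ⟨h, r, hr, Side.of_connected (h.connected q) hq hz hzr⟩
  have hgood : ∀ {h : MinorModel T T} {q r : V} (hqr : T.Adj q r),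
      (∀ z ∈ h.branch q, Side T q r z) → IsBranching T q → Good (⟨(q, r), hqr⟩ : T.Dart) := by
    intro h q r hqr hh hbq
    obtain ⟨y, hy, hby⟩ := h.exists_isBranching hbq
    exact ⟨y, hh y hy, hby⟩
  obtain ⟨h₀, r₀, hr₀, hh₀⟩ := hmove b
  obtain ⟨x, hx, hadj, -, ⟨y, hy, hby⟩, -⟩ := hT.exists_isBareRay
    (Q := fun p q => ∃ hpq : T.Adj p q, (∃ h : MinorModel T T, ∀ z ∈ h.branch p, Side T p q z) ∧
      Good (⟨(p, q), hpq⟩ : T.Dart) ∧ Good (⟨(q, p), hpq.symm⟩ : T.Dart)) (by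
      rintro p q - ⟨hpq, ⟨h₁, hh₁⟩, hg, hg'⟩
      obtain ⟨h, r, hqr, hh⟩ := hmove q
      have hrp : r ≠ p := by
        rintro rfl
        obtain ⟨h1, h2⟩ := pivot_of_flip hT hg hg' hh₁ hh
        exact hno ⟨r, q, h1, h₁, h2⟩
      refine ⟨r, hqr, hrp, hqr, ⟨h, hh⟩, ?_, ?_⟩
      -- If `q` is branching, so is some vertex of its moved piece, which lies ahead. Otherwise `r`
      -- is the only way on from `q`, and the branching vertex ahead of `p` lies beyond it.
      · by_cases hbq : IsBranching T q
        · exact hgood hqr hh hbq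
        · obtain ⟨y, hy, hby⟩ := hg
          rcases Side.cases_next hy with rfl | ⟨c, hc, hcp, hcy⟩
          · exact absurd hby hbq
          · rcases eq_or_eq_of_not_isBranching hbq hpq.symm hqr hrp.symm hc with rfl | rfl
            · exact absurd rfl hcp
            · exact ⟨y, hcy, hby⟩
      · obtain ⟨y, hy, hby⟩ := hg'
        exact ⟨y, (Side.subset_of_ne hac hqr.symm hpq.symm hrp.symm hy).1, hby⟩)
    hr₀ ⟨hr₀, ⟨h₀, hh₀⟩, hgood hr₀ hh₀ hb, b, .base, hb⟩
  exact hx.not_isBranching hy hby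

/-- Self-models cannot expand each of two vertices over the path between them. -/
theorem eq_of_expansions (hT : IsSmallTree T) (hS : S.IsTree) (g : MinorModel S T) {b : W}
    (hb : IsBranching S b) {p q : W} {h k : MinorModel S S} (hpp : p ∈ h.branch p)
    (hqp : q ∈ h.branch p) (hpq : p ∈ k.branch q) (hqq : q ∈ k.branch q) : p = q := by
  by_contra hne
  have hac := hS.isAcyclic
  obtain ⟨r, hr, hqr⟩ := Side.exists_adj hS.connected (Ne.symm hne)
  obtain ⟨s, hs, hps⟩ := Side.exists_adj hS.connected hne
  have hsub : ∀ {p q r s : W}, S.Adj p r → Side S p r q → Side S q s p →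
      ∀ x, Side S r p x → Side S q s x := by
    intro p q r s hr hqr hps
    refine Side.of_connected (RootTree.side_connected S r p) ?_ Side.base hps
    exact Side.not_both hac hr hqr
  -- The image of the edge leaves a piece containing both `p` and `q`, so it points away from both;
  -- it starts ahead of one of the two edges.
  have key : ∀ {p q r s : W} (hr : S.Adj p r) (hs : S.Adj q s), Side S p r q → Side S q s p →
      ∀ (h : MinorModel S S), p ∈ h.branch p → q ∈ h.branch p → ∀ f,
      MapsTo h ⟨(p, r), hr⟩ f → Before ⟨(p, r), hr⟩ f ∨ Before ⟨(q, s), hs⟩ f := by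
    intro p q r s hr hs hqr hps h hpp hqp f hf
    have h1 : ∀ y ∈ h.branch p, ¬ Side S f.fst f.snd y := fun y hy =>
      Side.not_both hac f.adj.symm (hf.symm.side Side.base y hy)
    by_cases ha : Side S p r f.fst
    · exact Or.inl ⟨ha, h1 p hpp⟩
    · exact Or.inr ⟨hsub hr hqr hps _ ((Side.not_iff hS hr).1 ha), h1 q hqp⟩
  -- Neither edge can be pushed beyond itself, so `h` pushes the first beyond the second and `k` the
  -- second beyond the first; then `k.comp h` pushes the first beyond itself.
  have main : ∀ {p q r s : W} (hr : S.Adj p r) (hs : S.Adj q s), Side S p r q → Side S q s p →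
      ∀ (h k : MinorModel S S), p ∈ h.branch p → q ∈ h.branch p → p ∈ k.branch q →
      q ∈ k.branch q → ¬ Good (⟨(p, r), hr⟩ : S.Dart) := by
    intro p q r s hr hs hqr hps h k hpp hqp hpq hqq hg
    obtain ⟨f, hf⟩ := exists_mapsTo h ⟨(p, r), hr⟩
    rcases key hr hs hqr hps h hpp hqp f hf with h1 | h1
    · exact not_before_of_mapsTo hT hS g h hg hf h1
    · have hg' := h1.good (hf.good hg)
      obtain ⟨f', hf'⟩ := exists_mapsTo k ⟨(q, s), hs⟩
      rcases key hs hr hps hqr k hqq hpq f' hf' with h2 | h2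
      · exact not_before_of_mapsTo hT hS g k hg' hf' h2
      · obtain ⟨f'', hf''⟩ := exists_mapsTo k f
        exact not_before_of_mapsTo hT hS g (k.comp h) hg (hf.comp hf'')
          (h2.trans (hf'.before hS hac hf'' h1))
  rcases Side.cover hS.connected (a := p) (b := r) b with h1 | h1
  · exact main hr hs hqr hps h k hpp hqp hpq hqq ⟨b, h1, hb⟩
  · exact main hs hr hps hqr k h hqq hpq hqp hpp ⟨b, hsub hr hqr hps b h1, hb⟩

end pivot

/-! ### Unrooted trees -/

section unrooted

open RootTree

variable {V : Type u} {T : SimpleGraph V}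

/-- The round trip through `S` brings `x` back into the piece of `x` or `y`, and the vertex of `S`
it passes through is the root. In the second case, `h₀` is applied beforehand to turn `x` into `y`.
-/
theorem exists_equi_root {W : Type u} {S : SimpleGraph W} (hT : T.IsTree) (hS : S.IsTree)
    {x y : V} (hxy : ∀ h : MinorModel T T, x ∈ h.branch x ∨ x ∈ h.branch y)
    {h₀ : MinorModel T T} (hy : y ∈ h₀.branch x) (h : AreMutualMinors T S) :
    ∃ w, Equi ⟨W, S, hS, w⟩ ⟨V, T, hT, x⟩ := by
  obtain ⟨⟨f⟩, ⟨g⟩⟩ := h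
  rcases hxy (g.comp f) with ⟨w, hw, hx⟩ | ⟨w, hw, hx⟩
  · exact ⟨w, ⟨g, hx⟩, ⟨f, hw⟩⟩
  · exact ⟨w, ⟨g, hx⟩, ⟨f.comp h₀, y, hy, hw⟩⟩

/-- By the pivot property each such root lies in the piece of `x` or of `y` under one fixed model,
and by `eq_of_expansions` neither piece contains two of them. -/
theorem not_three_roots {W : Type u} {S : SimpleGraph W} (hT : IsSmallTree T) (hS : S.IsTree)
    {b : V} (hb : IsBranching T b)
    {x y : V} (hxy : ∀ h : MinorModel T T, x ∈ h.branch x ∨ x ∈ h.branch y)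
    {h₀ : MinorModel T T} (hy : y ∈ h₀.branch x) (w : Fin 3 → W) (hw : Function.Injective w) :
    ¬ ∀ i, Equi ⟨W, S, hS, w i⟩ ⟨V, T, hT.isTree, x⟩ := by
  intro h
  obtain ⟨f, -⟩ := (h 0).2
  have hg : ∀ i, ∃ g : MinorModel S T, x ∈ g.branch (w i) := fun i => (h i).1
  choose g hg using hg
  have hf : ∀ i, w i ∈ f.branch x ∨ w i ∈ f.branch y := by
    intro i
    rcases hxy ((g i).comp f) with ⟨z, hz, hx⟩ | ⟨z, hz, hx⟩
    · exact Or.inl ((g i).eq_of_mem hx (hg i) ▸ hz)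
    · exact Or.inr ((g i).eq_of_mem hx (hg i) ▸ hz)
  have key : ∀ (k : MinorModel T S) i j, w i ∈ k.branch x → w j ∈ k.branch x → i = j := by
    intro k i j hi hj
    obtain ⟨b', -, hb'⟩ := k.exists_isBranching hb
    exact hw (eq_of_expansions hT hS (g i) hb' (h := k.comp (g i)) (k := k.comp (g j))
      ⟨x, hg i, hi⟩ ⟨x, hg i, hj⟩ ⟨x, hg j, hi⟩ ⟨x, hg j, hj⟩)
  have key1 : ∀ i j, w i ∈ f.branch x → w j ∈ f.branch x → i = j := key f
  have key2 : ∀ i j, w i ∈ f.branch y → w j ∈ f.branch y → i = j := fun i j hi hj =>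
    key (f.comp h₀) i j ⟨y, hy, hi⟩ ⟨y, hy, hj⟩
  have h01 : (0 : Fin 3) ≠ 1 := by decide
  have h02 : (0 : Fin 3) ≠ 2 := by decide
  have h12 : (1 : Fin 3) ≠ 2 := by decide
  rcases hf 0 with h0 | h0 <;> rcases hf 1 with h1 | h1 <;> rcases hf 2 with h2 | h2
  · exact h01 (key1 _ _ h0 h1)
  · exact h01 (key1 _ _ h0 h1)
  · exact h02 (key1 _ _ h0 h2)
  · exact h12 (key2 _ _ h1 h2)
  · exact h12 (key1 _ _ h1 h2)
  · exact h02 (key2 _ _ h0 h2)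
  · exact h01 (key2 _ _ h0 h1)
  · exact h01 (key2 _ _ h0 h1)

theorem mk_mutualMinorClass_eq_one (hT : T.IsTree)
    (h : ∀ {W : Type u} (S : SimpleGraph W), S.IsTree → AreMutualMinors T S →
      Nonempty (T ≃g S)) : #(MutualMinorClass T) = 1 := by
  rw [Cardinal.eq_one_iff_unique]
  constructor
  · constructor
    intro a b
    induction a, b using Quotient.inductionOn₂ with
    | h A B =>
      obtain ⟨e⟩ := h A.graph A.isTree A.mutual_minors
      obtain ⟨f⟩ := h B.graph B.isTree B.mutual_minors
      exact Quotient.sound ⟨e.symm.trans f⟩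
  · have m : MinorModel T T := MinorModel.ofIso SimpleGraph.Iso.refl
    exact ⟨Quotient.mk _ ⟨V, T, hT, ⟨m⟩, ⟨m⟩⟩⟩

/-- With finitely many unrooted types, infinitely many rooted types would share one tree; their
roots there are distinct, and three of them contradict `not_three_roots`. -/
theorem infinite_mutualMinorClass (hT : IsSmallTree T) {b : V} (hb : IsBranching T b)
    {x y : V} (hxy : ∀ h : MinorModel T T, x ∈ h.branch x ∨ x ∈ h.branch y)
    {h₀ : MinorModel T T} (hy : y ∈ h₀.branch x) (hmany : ManyTypes ⟨V, T, hT.isTree, x⟩) :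
    Infinite (MutualMinorClass T) := by
  obtain ⟨s, hs, hs'⟩ := hmany
  let A : ℕ → MutualMinorTree T := fun n => ⟨(s n).Vert, (s n).graph, (s n).isTree,
    ⟨(hs n).2.elim fun m _ => ⟨m⟩, (hs n).1.elim fun m _ => ⟨m⟩⟩⟩
  by_contra hfin
  have hfin : Finite (Quotient (MutualMinorTree.isoSetoid T)) := not_infinite_iff_finite.1 hfin
  obtain ⟨c, hc⟩ := Finite.exists_infinite_fiber
    (fun n => (Quotient.mk (MutualMinorTree.isoSetoid T) (A n) : MutualMinorClass T))
  let ι := Infinite.natEmbedding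
    ((fun n => (Quotient.mk (MutualMinorTree.isoSetoid T) (A n) : MutualMinorClass T)) ⁻¹' {c})
  let n : ℕ → ℕ := fun k => (ι k).1
  have hn : Function.Injective n := fun a b h => ι.injective (Subtype.ext h)
  have he : ∀ k, Nonempty ((s (n k)).graph ≃g (s (n 0)).graph) := fun k =>
    Quotient.exact (s := MutualMinorTree.isoSetoid T) ((ι k).2.trans (ι 0).2.symm)
  let e := fun k => (he k).some
  have hiso : ∀ k, IsIso (s (n k)) ⟨_, (s (n 0)).graph, (s (n 0)).isTree, e k (s (n k)).root⟩ :=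
    fun k => ⟨e k, rfl⟩
  refine not_three_roots hT (s (n 0)).isTree hb hxy hy
    (fun i : Fin 3 => e i (s (n i)).root) ?_ ?_
  · intro i j hij
    by_contra hne
    have h1 : n i ≠ n j := fun h => hne (Fin.ext (hn h))
    have h2 := hiso i
    have h3 : e i (s (n i)).root = e j (s (n j)).root := hij
    rw [h3] at h2
    exact hs' _ _ h1 (h2.trans (hiso j).symm)
  · exact fun i => (hiso i).symm.equi.trans (hs _)

end unrooted

theorem mainTheorem6 {V : Type u} (T : SimpleGraph V) (hT : IsSmallTree T) :
    #(MutualMinorClass T) = 1 ∨ ℵ₀ ≤ #(MutualMinorClass T) := by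
  by_cases hbr : ∃ b, IsBranching T b
  · obtain ⟨b, hb⟩ := hbr
    obtain ⟨x, y, hxy, h₀, hy⟩ := exists_pivot hT hb
    rcases RootTree.dichotomy_of_isSmallTree (t := ⟨V, T, hT.isTree, x⟩) hT with h | h
    · refine Or.inl (mk_mutualMinorClass_eq_one hT.isTree fun S hS hTS => ?_)
      obtain ⟨w, hw⟩ := exists_equi_root hT.isTree hS hxy hy hTS
      obtain ⟨e, -⟩ := (h _ hw).symm
      exact ⟨e⟩
    · exact Or.inr (Cardinal.infinite_iff.1 (infinite_mutualMinorClass hT hb hxy hy h))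
  · push Not at hbr
    exact Or.inl (mk_mutualMinorClass_eq_one hT.isTree fun S hS hTS =>
      nonempty_iso_of_not_isBranching hT.isTree hS hbr hTS)
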